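/- Let $n \ge 1$, $J, I \ge 0$, $0=\tau_0<\tau_1<\dots<\tau_J<\tau_{J+1}=\tau$, and fix an inner product $\langle\cdot,\cdot\rangle$ on $\mathbb{R}^n$ (adjoints of $n\times n$-matrices are taken w.r.t. it). Let $\rho$ be a function on $[-\tau,0]$ with $\inf\rho>0$ which on each $(-\tau_{j+1},-\tau_j)$, $0\le j\le J$, extends to a $C^1$ function on $[-\tau_{j+1},-\tau_j]$; $\rho(0)$ and $\rho(-\tau)$ denote the values of these extensions, and $\Delta_j(f)=f(-\tau_j+0)-f(-\tau_j-0)$ for $1\le j\le J$. Let $\mathbb{H}=\mathbb{R}^n\times L_2(-\tau,0;\mathbb{R}^n)$ with $$\langle (x,\phi),(y,\psi)\rangle_\rho=\langle x,y\rangle+\int_{-\tau}^0\rho(\theta)\langle\phi(\theta),\psi(\theta)\rangle\,d\theta .$$ Let $L_0,L_{-\tau},L_{-\tau_1},\dots,L_{-\tau_J}$ be $n\times n$-matrices, $M_1,\dots,M_I$ be $L_2$-functions on $(-\tau,0)$ with values in the $n\times n$-matrices, and let $L(x,\phi)=(\widetilde L\phi,\phi')$ with domain $\mathcal{D}(L)=\{(x,\phi)\in\mathbb{H}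 : \phi\in W^{1,2}(-\tau,0;\mathbb{R}^n),\ \phi(0)=x\}$, where $$\widetilde L\phi=L_0\phi(0)+L_{-\tau}\phi(-\tau)+\sum_{j=1}^J L_{-\tau_j}\phi(-\tau_j)+\sum_{i=1}^I\int_{-\tau}^0 M_i(\theta)\phi(\theta)\,d\theta .$$ For an operator $A$ in $\mathbb{H}$ the trace numbers $\beta_1(A),\beta_2(A),\dots$ are defined inductively by $$\beta_1(A)+\dots+\beta_k(A)=\sup_{\mathbb{L}\subset\mathcal{D}(A),\ \dim\mathbb{L}=k}\operatorname{Tr}(\Pi_{\mathbb{L}}A\Pi_{\mathbb{L}}),$$ $\Pi_{\mathbb{L}}$ being the orthogonal projector onto the linear subspace $\mathbb{L}$. An additive symmetrization of $A$ is a self-adjoint operator extending $(A+A^*)/2$ from $\mathcal{D}(A)\cap\mathcal{D}(A^*)$, where this intersection is dense; it is proper if it has the same trace numbers as $A$. 1. $L$ is densely defined. $\mathcal{D}(L^*)$ consists of all $(y,\psi)\in\mathbb{H}$ such that $\psi\in W^{1,2}(-\tau_{j+1},-\tau_j;\mathbb{R}^n)$ for $0\le j\le J$ and $$L_{-\tau}^*y=\rho(-\tau)\psi(-\tau),\qquad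 L_{-\tau_j}^*y=\Delta_j(\rho\psi)\quad(1\le j\le J),$$ and, with $\psi'$ and $\rho'$ being the piecewise derivatives, $$L^*(y,\psi)=\Big(L_0^*y+\rho(0)\psi(0),\ -\psi'-\frac{\rho'}{\rho}\psi+\frac{1}{\rho}\sum_{i=1}^I M_i^*y\Big).$$ 2. If $\Delta_j(\rho)\ne0$ for $1\le j\le J$, then $L$ has a unique additive symmetrization $S_L$. It is a bounded self-adjoint operator on $\mathbb{H}$, and $S_L(x,\phi)=\frac12(y,\psi)$ with $$y=\Big(L_0+L_0^*+\rho(0)I_n+\frac{L_{-\tau}L_{-\tau}^*}{\rho(-\tau)}+\sum_{j=1}^J\frac{L_{-\tau_j}L_{-\tau_j}^*}{\Delta_j(\rho)}\Big)x+\sum_{i=1}^I\int_{-\tau}^0M_i(\theta)\phi(\theta)\,d\theta,\qquad \psi=-\frac{\rho'}{\rho}\phi+\frac1\rho\sum_{i=1}^IM_i^*x .$$ 3. If $\rho(\theta)=e^{\varkappa_j\theta}$ on $(-\tau_{j+1},-\tau_j)$ for $0\le j\le J$ with some reals $\varkappa_0,\dots,\varkappa_J$, and $\Delta_j(\rho)>0$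 for $1\le j\le J$, then all $\beta_k(L)$ are finite, for every $k\ge1$ $$\sum_{j=1}^k\beta_j(L)=\sup_{\mathbb{L}\subset\mathcal{D}(L)\cap\mathcal{D}(L^*),\ \dim\mathbb{L}=k}\operatorname{Tr}(\Pi_{\mathbb{L}}L\Pi_{\mathbb{L}}),$$ and $S_L$ is proper: $\beta_k(L)=\beta_k(S_L)$ for every $k\ge1$. -/

import Mathlib

open MeasureTheory Set
open scoped ContDiff

noncomputable section

namespace DelaySymm

/-! ### Trace numbers and additive symmetrizations of operators in a real Hilbert space -/

section Operators

variable {H : Type*} [NormedAddCommGroup H] [InnerProductSpace ℝ H]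

/-- The trace of `Π_V ∘ A ∘ Π_V` for a finite-dimensional subspace `V ⊆ D(A)`, where `Π_V` is the
orthogonal projector onto `V`. This operator vanishes on `Vᗮ` and has range in `V`, so its trace is
the trace of the endomorphism `v ↦ Π_V (A v)` of `V`. -/
def compressionTrace (A : H →ₗ.[ℝ] H) (V : Submodule ℝ H) [FiniteDimensional ℝ V]
    (hV : V ≤ A.domain) : ℝ :=
  LinearMap.trace ℝ V
    ((V.orthogonalProjectionOnto : H →ₗ[ℝ] V) ∘ₗ A.toFun ∘ₗ Submodule.inclusion hV)

/-- The supremum, in the extended reals, of `Tr (Π_V ∘ A ∘ Π_V)` over all `k`-dimensional subspaces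
`V` of `D(A) ∩ D`. -/
def traceSupOn (A : H →ₗ.[ℝ] H) (D : Submodule ℝ H) (k : ℕ) : EReal :=
  ⨆ (V : Submodule ℝ H) (hV : V ≤ A.domain ⊓ D) (_ : FiniteDimensional ℝ V)
    (_ : Module.finrank ℝ V = k), ((compressionTrace A V (hV.trans inf_le_left) : ℝ) : EReal)

/-- The supremum over all `k`-dimensional subspaces of `D(A)`. For `k = 0` it is `0`. -/
def traceSup (A : H →ₗ.[ℝ] H) (k : ℕ) : EReal := traceSupOn A A.domain k

/-- The trace numbers `β_k(A)`, `k = 1, 2, …`, determined by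
`β_1(A) + ⋯ + β_k(A) = traceSup A k`, with `β_k(A) = +∞` where the supremum is `+∞`. -/
def traceNumber (A : H →ₗ.[ℝ] H) (k : ℕ) : EReal :=
  open Classical in
  if traceSup A k = ⊤ then ⊤ else traceSup A k - traceSup A (k - 1)

/-- `S` is an additive symmetrization of `A`: the domain `D(A) ∩ D(A*)` of `(A + A*)/2` is dense
and `S` is a self-adjoint operator which extends `(A + A*)/2`. -/
def IsAdditiveSymmetrization [CompleteSpace H] (A S : H →ₗ.[ℝ] H) : Prop :=
  Dense ((A.domain ⊓ A.adjoint.domain : Submodule ℝ H) : Set H) ∧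
    IsSelfAdjoint S ∧ (1 / 2 : ℝ) • (A + A.adjoint) ≤ S

/-- `S` is a proper additive symmetrization of `A`. -/
def IsProperAdditiveSymmetrization [CompleteSpace H] (A S : H →ₗ.[ℝ] H) : Prop :=
  IsAdditiveSymmetrization A S ∧ ∀ k : ℕ, 1 ≤ k → traceNumber A k = traceNumber S k

end Operators

/-! ### Weak derivatives, partitions and weights -/

section Functions

variable {E : Type*} [NormedAddCommGroup E] [InnerProductSpace ℝ E]

/-- `g` is the weak derivative of `f` on the interval `(a, b)`. -/
def HasWeakDeriv (a b : ℝ) (f g : ℝ → E) : Prop :=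
  ∀ η : ℝ → ℝ, ContDiff ℝ ∞ η → HasCompactSupport η → tsupport η ⊆ Ioo a b →
    ∫ θ in Ioo a b, deriv η θ • f θ = -∫ θ in Ioo a b, η θ • g θ

/-- The jump `f(t+0) - f(t-0)`. -/
def jump (f : ℝ → E) (t : ℝ) : E := Function.rightLim f t - Function.leftLim f t

end Functions

/-- Delays `0 = τ_0 < τ_1 < ⋯ < τ_J < τ_{J+1} = τ`. -/
structure DelayPartition (J : ℕ) where
  τ : Fin (J + 2) → ℝ
  τ_zero : τ 0 = 0
  strictMono : StrictMono τ

namespace DelayPartition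

variable {J : ℕ} (P : DelayPartition J)

/-- The largest delay `τ = τ_{J+1}`. -/
def delay : ℝ := P.τ (Fin.last (J + 1))

/-- The interior node `-τ_{j+1}` for `j = 0, …, J - 1`. -/
def node (j : Fin J) : ℝ := -P.τ j.succ.castSucc

/-- The left end `-τ_{j+1}` of the `j`-th segment, `j = 0, …, J`. -/
def left (j : Fin (J + 1)) : ℝ := -P.τ j.succ

/-- The right end `-τ_j` of the `j`-th segment, `j = 0, …, J`. -/
def right (j : Fin (J + 1)) : ℝ := -P.τ j.castSucc

theorem delay_pos : 0 < P.delay := by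
  rw [← P.τ_zero]
  exact P.strictMono (Fin.last_pos)

end DelayPartition

/-- A positive weight on `[-τ, 0]`, bounded away from zero and `C¹` on each closed segment
`[-τ_{j+1}, -τ_j]` after extension by continuity from the open one. -/
structure Weight {J : ℕ} (P : DelayPartition J) where
  ρ : ℝ → ℝ
  contDiff : ∀ j : Fin (J + 1), ∃ r : ℝ → ℝ,
    ContDiffOn ℝ 1 r (Icc (P.left j) (P.right j)) ∧ EqOn ρ r (Ioo (P.left j) (P.right j))
  pos : ∃ c : ℝ, 0 < c ∧ ∀ θ ∈ Icc (-P.delay) 0, c ≤ ρ θ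

namespace Weight

variable {J : ℕ} {P : DelayPartition J} (W : Weight P)

theorem aemeasurable : AEMeasurable W.ρ (volume.restrict (Ioo (-P.delay) 0)) := by
  have hcover : Ioo (-P.delay) 0 ⊆ ⋃ j, Icc (P.left j) (P.right j) := by
    intro θ hθ
    by_contra hn
    simp only [mem_iUnion, mem_Icc, not_exists, not_and, not_le] at hn
    have key : ∀ i : Fin (J + 2), P.τ i < -θ := by
      refine Fin.induction ?_ ?_
      · rw [P.τ_zero]
        linarith [hθ.2]
      · intro i hi
        by_contra hc
        have h1 := hn i (by simp only [DelayPartition.left]; linarith)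
        simp only [DelayPartition.right] at h1
        linarith
    have h2 := key (Fin.last (J + 1))
    have h3 := hθ.1
    simp only [DelayPartition.delay] at h3
    linarith
  refine AEMeasurable.mono_measure ?_ (Measure.restrict_mono hcover le_rfl)
  rw [aemeasurable_iUnion_iff]
  intro j
  obtain ⟨r, hr, he⟩ := W.contDiff j
  rw [← restrict_Ioo_eq_restrict_Icc]
  refine AEMeasurable.congr ((hr.continuousOn.mono Ioo_subset_Icc_self).aemeasurable
    measurableSet_Ioo) ?_
  filter_upwards [ae_restrict_mem measurableSet_Ioo] with θ hθ
  exact (he hθ).symm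

/-- The measure `ρ(θ) dθ` on `(-τ, 0)`. -/
def measure : Measure ℝ :=
  (volume.restrict (Ioo (-P.delay) 0)).withDensity fun θ => ENNReal.ofReal (W.ρ θ)

theorem exists_volume_le : ∃ c : ENNReal, c ≠ ⊤ ∧
    volume.restrict (Ioo (-P.delay) 0) ≤ c • W.measure := by
  obtain ⟨c, hc, h⟩ := W.pos
  have hc0 : ENNReal.ofReal c ≠ 0 := by simpa using hc
  refine ⟨(ENNReal.ofReal c)⁻¹, by simpa using hc, Measure.le_iff.2 fun s hs => ?_⟩
  rw [Measure.smul_apply, smul_eq_mul, measure, withDensity_apply _ hs,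
    ← ENNReal.div_eq_inv_mul, ENNReal.le_div_iff_mul_le (Or.inl hc0) (Or.inl ENNReal.ofReal_ne_top),
    mul_comm, ← setLIntegral_const]
  refine lintegral_mono_ae (ae_restrict_of_ae ?_)
  filter_upwards [ae_restrict_mem measurableSet_Ioo] with θ hθ
  exact ENNReal.ofReal_le_ofReal (h θ (Ioo_subset_Icc_self hθ))

theorem volume_absolutelyContinuous : volume.restrict (Ioo (-P.delay) 0) ≪ W.measure := by
  obtain ⟨c, _, h⟩ := W.exists_volume_le
  exact (Measure.absolutelyContinuous_of_le h).trans (Measure.smul_absolutelyContinuous)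

theorem absolutelyContinuous_volume : W.measure ≪ volume.restrict (Ioo (-P.delay) 0) :=
  withDensity_absolutelyContinuous _ _

theorem ae_eq_volume {E : Type*} {f g : ℝ → E} (h : f =ᵐ[W.measure] g) :
    f =ᵐ[volume.restrict (Ioo (-P.delay) 0)] g :=
  W.volume_absolutelyContinuous.ae_le h

theorem memLp_volume {E : Type*} [NormedAddCommGroup E] (φ : Lp E 2 W.measure) :
    MemLp φ 2 (volume.restrict (Ioo (-P.delay) 0)) := by
  obtain ⟨c, hc, h⟩ := W.exists_volume_le
  exact (Lp.memLp φ).of_measure_le_smul hc h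

end Weight

/-! ### The Hilbert space `ℍ` and the delay operator -/

section Delay

variable {E : Type*} [NormedAddCommGroup E] [InnerProductSpace ℝ E]

/-- The Hilbert space `E × L₂(-τ, 0; E)` with the inner product
`⟨x, y⟩ + ∫_{-τ}^0 ρ(θ) ⟨φ(θ), ψ(θ)⟩ dθ`. -/
abbrev DelaySpace (E : Type*) [NormedAddCommGroup E] [InnerProductSpace ℝ E] {J : ℕ}
    {P : DelayPartition J} (W : Weight P) : Type _ :=
  WithLp 2 (E × Lp E 2 W.measure)

theorem inner_delaySpace {J : ℕ} {P : DelayPartition J} (W : Weight P) (p q : DelaySpace E W) :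
    inner ℝ p q = inner ℝ p.fst q.fst +
      ∫ θ in Ioo (-P.delay) 0, W.ρ θ * inner ℝ (p.snd θ) (q.snd θ) := by
  rw [WithLp.prod_inner_apply, L2.inner_def]
  congr 1
  refine (integral_withDensity_eq_integral_toReal_smul₀ W.aemeasurable.ennreal_ofReal
    (Filter.Eventually.of_forall fun θ => ENNReal.ofReal_lt_top) _).trans ?_
  obtain ⟨c, hc, h⟩ := W.pos
  refine setIntegral_congr_fun measurableSet_Ioo fun θ hθ => ?_
  simp only [smul_eq_mul]
  rw [ENNReal.toReal_ofReal (hc.le.trans (h θ (Ioo_subset_Icc_self hθ)))]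
  rfl

/-- The coefficients of a delay functional
`φ ↦ L_0 φ(0) + L_{-τ} φ(-τ) + ∑_j L_{-τ_j} φ(-τ_j) + ∑_i ∫_{-τ}^0 M_i(θ) φ(θ) dθ`. -/
structure DelayCoeffs (E : Type*) [NormedAddCommGroup E] [InnerProductSpace ℝ E] {J : ℕ}
    (P : DelayPartition J) (I : ℕ) where
  L₀ : E →L[ℝ] E
  Lτ : E →L[ℝ] E
  Lj : Fin J → E →L[ℝ] E
  M : Fin I → ℝ → E →L[ℝ] E
  memLp : ∀ i, MemLp (M i) 2 (volume.restrict (Ioo (-P.delay) 0))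

variable {J I : ℕ} {P : DelayPartition J}

/-- The integral term `∑_i ∫_{-τ}^0 M_i(θ) φ(θ) dθ`. -/
def DelayCoeffs.integralPart (C : DelayCoeffs E P I) (φ : ℝ → E) : E :=
  ∑ i, ∫ θ in Ioo (-P.delay) 0, C.M i θ (φ θ)

/-- The delay functional on functions `φ` on `[-τ, 0]`. -/
def DelayCoeffs.functional (C : DelayCoeffs E P I) (φ : ℝ → E) : E :=
  C.L₀ (φ 0) + C.Lτ (φ (-P.delay)) + ∑ j, C.Lj j (φ (P.node j)) + C.integralPart φ

/-- `(x, φ) ∈ D(L)` and `L (x, φ) = (z, χ)`. That is, `φ` has the weak derivative `χ ∈ L₂`,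
its continuous representative `u` has the value `x` at `0`, and `z` is the value of the
delay functional at `u`. -/
def DelayRel (W : Weight P) (C : DelayCoeffs E P I) (p q : DelaySpace E W) : Prop :=
  ∃ u : ℝ → E, ContinuousOn u (Icc (-P.delay) 0) ∧
    p.snd =ᵐ[volume.restrict (Ioo (-P.delay) 0)] u ∧
    HasWeakDeriv (-P.delay) 0 u q.snd ∧ u 0 = p.fst ∧ q.fst = C.functional u

theorem integrable_of_continuousOn {u : ℝ → E} {a b : ℝ} (hu : ContinuousOn u (Icc a b))
    {η : ℝ → ℝ} (hη : Continuous η) :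
    Integrable (fun θ => η θ • u θ) (volume.restrict (Ioo a b)) :=
  ((hη.continuousOn.smul hu).integrableOn_Icc).mono_set Ioo_subset_Icc_self

theorem integrable_of_memLp {g : ℝ → E} {a b : ℝ}
    (hg : MemLp g 2 (volume.restrict (Ioo a b))) {η : ℝ → ℝ} (hη : Continuous η)
    (hc : HasCompactSupport η) :
    Integrable (fun θ => η θ • g θ) (volume.restrict (Ioo a b)) := by
  obtain ⟨K, hK⟩ := hc.exists_bound_of_continuous hη
  exact (hg.integrable one_le_two).bdd_smul K hη.aestronglyMeasurable
    (Filter.Eventually.of_forall hK)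

theorem DelayCoeffs.integrable (C : DelayCoeffs E P I) {u : ℝ → E}
    (hu : ContinuousOn u (Icc (-P.delay) 0)) (i : Fin I) :
    Integrable (fun θ => C.M i θ (u θ)) (volume.restrict (Ioo (-P.delay) 0)) := by
  have hM : Integrable (C.M i) (volume.restrict (Ioo (-P.delay) 0)) :=
    (C.memLp i).integrable one_le_two
  obtain ⟨K, hK⟩ := isCompact_Icc.exists_bound_of_continuousOn hu
  have hm : AEStronglyMeasurable u (volume.restrict (Ioo (-P.delay) 0)) :=
    (hu.mono Ioo_subset_Icc_self).aestronglyMeasurable measurableSet_Ioo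
  refine (hM.norm.mul_const K).mono' ?_ ?_
  · exact (ContinuousLinearMap.apply ℝ E).flip.aestronglyMeasurable_comp₂
      hM.aestronglyMeasurable hm
  · filter_upwards [ae_restrict_mem measurableSet_Ioo] with θ hθ
    exact ((C.M i θ).le_opNorm _).trans
      (mul_le_mul_of_nonneg_left (hK θ (Ioo_subset_Icc_self hθ)) (norm_nonneg _))

/-- The graph of the delay operator. -/
def delayGraph (W : Weight P) (C : DelayCoeffs E P I) :
    Submodule ℝ (DelaySpace E W × DelaySpace E W) where
  carrier := {pq | DelayRel W C pq.1 pq.2}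
  zero_mem' := by
    refine ⟨0, continuousOn_const, ?_, ?_, rfl, ?_⟩
    · exact W.ae_eq_volume (Lp.coeFn_zero E 2 W.measure)
    · intro η _ _ _
      have h := W.ae_eq_volume (Lp.coeFn_zero E 2 W.measure)
      have h2 : ∫ θ in Ioo (-P.delay) 0, η θ • (0 : Lp E 2 W.measure) θ = 0 := by
        refine integral_eq_zero_of_ae ?_
        filter_upwards [h] with θ hθ
        rw [hθ]
        exact smul_zero _
      change _ = -∫ θ in Ioo (-P.delay) 0, η θ • (0 : Lp E 2 W.measure) θ
      rw [h2]
      simp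
    · simp [DelayCoeffs.functional, DelayCoeffs.integralPart]
  add_mem' := by
    rintro ⟨p, q⟩ ⟨p', q'⟩ ⟨u, hu, hpu, hd, h0, hq⟩ ⟨u', hu', hpu', hd', h0', hq'⟩
    refine ⟨u + u', hu.add hu', ?_, ?_, ?_, ?_⟩
    · exact (W.ae_eq_volume (Lp.coeFn_add p.snd p'.snd)).trans
        (hpu.add hpu')
    · intro η hη hc hs
      have h := W.ae_eq_volume (Lp.coeFn_add q.snd q'.snd)
      have hη' : Continuous (deriv η) := hη.continuous_deriv (by simp)
      have e1 : ∫ θ in Ioo (-P.delay) 0, η θ • (q.snd + q'.snd : Lp E 2 W.measure) θ =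
          ∫ θ in Ioo (-P.delay) 0, (η θ • q.snd θ + η θ • q'.snd θ) := by
        refine integral_congr_ae ?_
        filter_upwards [h] with θ hθ
        rw [hθ, Pi.add_apply, smul_add]
      change _ = -∫ θ in Ioo (-P.delay) 0, η θ • (q.snd + q'.snd : Lp E 2 W.measure) θ
      rw [e1, integral_add (integrable_of_memLp (W.memLp_volume _) hη.continuous hc)
        (integrable_of_memLp (W.memLp_volume _) hη.continuous hc), neg_add, ← hd η hη hc hs,
        ← hd' η hη hc hs, ← integral_add (integrable_of_continuousOn hu hη')
        (integrable_of_continuousOn hu' hη')]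
      simp only [Pi.add_apply, smul_add]
    · simp [h0, h0']
    · change q.fst + q'.fst = _
      rw [hq, hq']
      have e2 : C.integralPart (u + u') = C.integralPart u + C.integralPart u' := by
        simp only [DelayCoeffs.integralPart, ← Finset.sum_add_distrib]
        refine Finset.sum_congr rfl fun i _ => ?_
        rw [← integral_add (C.integrable hu i) (C.integrable hu' i)]
        simp
      simp only [DelayCoeffs.functional, e2, Pi.add_apply, map_add, Finset.sum_add_distrib]
      abel
  smul_mem' := by
    rintro c ⟨p, q⟩ ⟨u, hu, hpu, hd, h0, hq⟩
    refine ⟨c • u, hu.const_smul c, ?_, ?_, ?_, ?_⟩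
    · exact (W.ae_eq_volume (Lp.coeFn_smul c p.snd)).trans
        (hpu.const_smul c)
    · intro η hη hc hs
      have h := W.ae_eq_volume (Lp.coeFn_smul c q.snd)
      have e1 : ∫ θ in Ioo (-P.delay) 0, η θ • (c • q.snd : Lp E 2 W.measure) θ =
          ∫ θ in Ioo (-P.delay) 0, c • (η θ • q.snd θ) := by
        refine integral_congr_ae ?_
        filter_upwards [h] with θ hθ
        rw [hθ, Pi.smul_apply, smul_comm]
      change _ = -∫ θ in Ioo (-P.delay) 0, η θ • (c • q.snd : Lp E 2 W.measure) θ
      rw [e1, integral_smul, ← smul_neg, ← hd η hη hc hs, ← integral_smul]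
      refine integral_congr_ae (Filter.Eventually.of_forall fun θ => ?_)
      exact smul_comm _ _ _
    · simp [h0]
    · change c • q.fst = _
      rw [hq]
      have e2 : C.integralPart (c • u) = c • C.integralPart u := by
        simp only [DelayCoeffs.integralPart, Finset.smul_sum]
        refine Finset.sum_congr rfl fun i _ => ?_
        rw [← integral_smul]
        simp
      simp only [DelayCoeffs.functional, e2, Pi.smul_apply, map_smul, Finset.smul_sum, smul_add]

/-- The delay operator `L : (x, φ) ↦ (L̃ φ, φ')` in `ℍ`, with the domain
`{(x, φ) | φ ∈ W^{1,2}(-τ, 0; E), φ(0) = x}`. -/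
def delayOperator (W : Weight P) (C : DelayCoeffs E P I) :
    DelaySpace E W →ₗ.[ℝ] DelaySpace E W :=
  (delayGraph W C).toLinearPMap

/-- The relation `DelayRel` is single-valued, so that it is the graph of the delay operator. -/
theorem mem_graph_delayOperator [CompleteSpace E] (W : Weight P) (C : DelayCoeffs E P I)
    (p q : DelaySpace E W) : (p, q) ∈ (delayOperator W C).graph ↔ DelayRel W C p q := by
  rw [delayOperator, Submodule.toLinearPMap_graph_eq]
  · rfl
  rintro ⟨p, q⟩ ⟨u, hu, hpu, hd, h0, hq⟩ hp
  obtain rfl : p = 0 := hp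
  have hz : (0 : Lp E 2 W.measure) =ᵐ[volume.restrict (Ioo (-P.delay) 0)] (0 : ℝ → E) :=
    W.ae_eq_volume (Lp.coeFn_zero E 2 W.measure)
  have hu0 : EqOn u 0 (Icc (-P.delay) 0) := by
    refine Measure.eqOn_Icc_of_ae_eq volume (by linarith [P.delay_pos] : -P.delay < 0).ne ?_ hu
      continuousOn_const
    rw [← restrict_Ioo_eq_restrict_Icc]
    exact hpu.symm.trans hz
  have hτ := P.delay_pos
  have hmem : ∀ j, P.node j ∈ Icc (-P.delay) 0 := fun j => by
    constructor
    · exact neg_le_neg (P.strictMono.monotone (Fin.le_last _))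
    · rw [DelayPartition.node, neg_nonpos, ← P.τ_zero]
      exact P.strictMono.monotone (Fin.zero_le _)
  have hfst : q.fst = 0 := by
    rw [show q.fst = C.functional u from hq, DelayCoeffs.functional,
      hu0 (right_mem_Icc.2 (by linarith)), hu0 (left_mem_Icc.2 (by linarith))]
    have e : C.integralPart u = 0 := by
      refine Finset.sum_eq_zero fun i _ => ?_
      refine (setIntegral_congr_fun (g := fun _ => (0 : E)) measurableSet_Ioo fun θ hθ => ?_).trans
        (by simp)
      simp [hu0 (Ioo_subset_Icc_self hθ)]
    simp [e, hu0 (hmem _)]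
  have hsnd : q.snd = 0 := by
    have hint : IntegrableOn q.snd (Ioo (-P.delay) 0) :=
      (W.memLp_volume q.snd).integrable one_le_two
    have key := isOpen_Ioo.ae_eq_zero_of_integral_contDiff_smul_eq_zero
      hint.locallyIntegrableOn fun η hη hc hs => by
        have h1 := hd η hη hc hs
        rw [setIntegral_congr_fun (g := fun _ => (0 : E)) measurableSet_Ioo fun θ hθ => by
          simp [hu0 (Ioo_subset_Icc_self hθ)]] at h1
        rw [integral_zero, zero_eq_neg] at h1
        rw [← h1, setIntegral_eq_integral_of_forall_compl_eq_zero]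
        intro θ hθ
        rw [image_eq_zero_of_notMem_tsupport fun h => hθ (hs h), zero_smul]
    rw [← ae_restrict_iff' measurableSet_Ioo] at key
    refine Lp.ext ?_
    have key' : q.snd =ᵐ[W.measure] (0 : ℝ → E) := W.absolutelyContinuous_volume.ae_le key
    exact key'.trans (Lp.coeFn_zero E 2 W.measure).symm
  exact (WithLp.equiv 2 _).injective (Prod.ext hfst hsnd)

/-! ### The explicit adjoint and the explicit symmetrization -/

/-- `ψ` belongs to the space `W^{1,2}` over the partition, i.e. it belongs to `W^{1,2}` on each
segment; `v` is its representative which is continuous up to the ends of each segment and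
`g ∈ L₂` is its piecewise weak derivative. -/
def IsPiecewiseSobolev (P : DelayPartition J) (ψ v g : ℝ → E) : Prop :=
  MemLp g 2 (volume.restrict (Ioo (-P.delay) 0)) ∧
  ∀ j : Fin (J + 1),
    ψ =ᵐ[volume.restrict (Ioo (P.left j) (P.right j))] v ∧
    (∃ r : ℝ → E, ContinuousOn r (Icc (P.left j) (P.right j)) ∧
      EqOn v r (Ioo (P.left j) (P.right j))) ∧
    HasWeakDeriv (P.left j) (P.right j) v g

variable [CompleteSpace E]

/-- The adjoint boundary conditions `L*_{-τ} y = ρ(-τ) ψ(-τ)` and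
`L*_{-τ_j} y = Δ_j(ρ ψ)` for the representative `v` of `ψ`. -/
def AdjointBoundary (W : Weight P) (C : DelayCoeffs E P I) (y : E) (v : ℝ → E) : Prop :=
  C.Lτ.adjoint y = Function.rightLim W.ρ (-P.delay) • Function.rightLim v (-P.delay) ∧
  ∀ j : Fin J, (C.Lj j).adjoint y = jump (fun θ => W.ρ θ • v θ) (P.node j)

/-- The matrix
`L_0 + L_0* + ρ(0) + L_{-τ} L*_{-τ} / ρ(-τ) + ∑_j L_{-τ_j} L*_{-τ_j} / Δ_j(ρ)`. -/
def symmMatrix (W : Weight P) (C : DelayCoeffs E P I) : E →L[ℝ] E :=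
  C.L₀ + C.L₀.adjoint + Function.leftLim W.ρ 0 • ContinuousLinearMap.id ℝ E +
    (Function.rightLim W.ρ (-P.delay))⁻¹ • (C.Lτ ∘L C.Lτ.adjoint) +
    ∑ j, (jump W.ρ (P.node j))⁻¹ • (C.Lj j ∘L (C.Lj j).adjoint)

end Delay

end DelaySymm

end

open DelaySymm

noncomputable section

namespace DelaySymm

/-! ### Primitives of integrable functions -/

section Primitive

variable {F G K : Type*} [NormedAddCommGroup F] [NormedSpace ℝ F] [NormedAddCommGroup G]
  [NormedSpace ℝ G] [NormedAddCommGroup K] [NormedSpace ℝ K]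

/-! Everything rests on one Green formula, `inner_green`. For p = (x, φ) in D(L) and s = (y, ψ) with
ψ piecewise Sobolev, integration by parts over each segment gives ⟨Lp, s⟩ = ⟨p, s♯⟩ + ⟨φ(-τ),
L*_{-τ}y - ρ(-τ)ψ(-τ)⟩ + ∑_j ⟨φ(-τ_j), L*_{-τ_j}y - Δ_j(ρψ)⟩, where s♯ (`adjointVector`) is the
expected formula for L*s.

Adjoint. If the boundary conditions hold, Green's formula says that s is in D(L*) and L*s = s♯.
Conversely, if ⟨Lp, s⟩ = ⟨p, t⟩ on D(L), test functions supported in one segment show that ρψ, and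
hence ψ, is Sobolev there. Green's formula then applies; test functions give equality of the
function components of t and s♯, and since the values of φ at 0, at -τ and at the nodes can be
prescribed independently, every boundary term vanishes and the vector components agree too
(`IsAdjointPair.eq_adjointVector`).

Symmetrization. On D(L) ∩ D(L*) the function φ is continuous, so Δ_j(ρφ) = Δ_j(ρ)φ(-τ_j) and the
boundary conditions express φ(-τ) and φ(-τ_j) through x. In L + L* the derivatives cancel and the
point values can be replaced, leaving a bounded symmetric operator. The common domain is dense, and
a self-adjoint operator which agrees on a dense subspace with a bounded self-adjoint one equals it
(`eq_toPMap_top_of_eqOn_dense`).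

Trace numbers. For all p in D(L), completing squares turns ⟨Lp, p⟩ - ⟨S_L p, p⟩ into -½ times a sum
of squares with weights ρ(-τ) and Δ_j(ρ), hence it is nonpositive when the jumps are positive
(`inner_delayOperator_le`); on D(L) ∩ D(L*) it vanishes. So the traces of L are at most those of
S_L. Conversely, any orthonormal k-tuple can be approximated from the dense common domain, and
Gram–Schmidt is continuous at independent tuples (`traceSup_toPMap_le_traceSupOn`). The three
suprema therefore coincide. They are finite because S_L is bounded and the space is
infinite-dimensional. -/

theorem intervalIntegral_eq_integral_indicator (k : ℝ → F) {a b t : ℝ} (ht : t ∈ Ioc a b) :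
    ∫ s in a..t, k s = ∫ s in Ioc a b, (Iic t).indicator k s := by
  rw [intervalIntegral.integral_of_le ht.1.le, integral_indicator measurableSet_Iic,
    Measure.restrict_restrict measurableSet_Iic]
  congr 2
  ext s
  simp only [mem_Ioc, mem_inter_iff, mem_Iic]
  constructor
  · rintro ⟨h1, h2⟩; exact ⟨h2, h1, h2.trans ht.2⟩
  · rintro ⟨h1, h2, _⟩; exact ⟨h2, h1⟩

/-- Fubini: the two terms on the left integrate B(g t)(h s) over the two triangles cut from the
square by its diagonal. This is integration by parts for primitives of merely integrable functions.
-/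
theorem integral_bilin_add_integral_bilin [CompleteSpace F] [CompleteSpace G] [CompleteSpace K]
    (B : F →L[ℝ] G →L[ℝ] K) {a b : ℝ} (hab : a ≤ b)
    {g : ℝ → F} {h : ℝ → G} (hg : IntegrableOn g (Ioc a b)) (hh : IntegrableOn h (Ioc a b)) :
    (∫ t in Ioc a b, B (g t) (∫ s in a..t, h s)) + (∫ t in Ioc a b, B (∫ s in a..t, g s) (h t)) =
      B (∫ s in a..b, g s) (∫ s in a..b, h s) := by
  set μ := volume.restrict (Ioc a b) with hμ
  have hprod : Integrable (fun z : ℝ × ℝ => B (g z.1) (h z.2)) (μ.prod μ) :=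
    Integrable.op_fst_snd (op := fun x y => B x y) (by fun_prop)
      ⟨‖B‖, fun x y => B.le_opNorm₂ x y⟩ hg hh
  have hS : MeasurableSet {z : ℝ × ℝ | z.2 ≤ z.1} := measurableSet_le measurable_snd measurable_fst
  have hS' : MeasurableSet {z : ℝ × ℝ | z.1 ≤ z.2} := measurableSet_le measurable_fst measurable_snd
  have e1 : ∫ t in Ioc a b, B (g t) (∫ s in a..t, h s) =
      ∫ t, ∫ s, ({z : ℝ × ℝ | z.2 ≤ z.1}.indicator fun z => B (g z.1) (h z.2)) (t, s) ∂μ ∂μ := by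
    refine setIntegral_congr_fun measurableSet_Ioc fun t ht => ?_
    rw [intervalIntegral_eq_integral_indicator h ht,
      ← ContinuousLinearMap.integral_comp_comm _ (hh.indicator measurableSet_Iic)]
    refine integral_congr_ae (Filter.Eventually.of_forall fun s => ?_)
    by_cases hs : s ≤ t <;> simp [indicator, hs]
  have e2 : ∫ t in Ioc a b, B (∫ s in a..t, g s) (h t) =
      ∫ t, ∫ s, ({z : ℝ × ℝ | z.1 ≤ z.2}.indicator fun z => B (g z.1) (h z.2)) (s, t) ∂μ ∂μ := by
    refine setIntegral_congr_fun measurableSet_Ioc fun t ht => ?_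
    rw [intervalIntegral_eq_integral_indicator g ht, ← B.flip_apply,
      ← ContinuousLinearMap.integral_comp_comm _ (hg.indicator measurableSet_Iic)]
    refine integral_congr_ae (Filter.Eventually.of_forall fun s => ?_)
    by_cases hs : s ≤ t <;> simp [indicator, hs]
  have e3 : B (∫ s in a..b, g s) (∫ s in a..b, h s) = ∫ z, B (g z.1) (h z.2) ∂(μ.prod μ) := by
    rw [integral_prod _ hprod, intervalIntegral.integral_of_le hab,
      intervalIntegral.integral_of_le hab, ← B.flip_apply,
      ← ContinuousLinearMap.integral_comp_comm _ hg]
    refine integral_congr_ae (Filter.Eventually.of_forall fun s => ?_)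
    simp only [ContinuousLinearMap.flip_apply]
    rw [← ContinuousLinearMap.integral_comp_comm _ hh]
  rw [e1, e2, e3, ← integral_prod _ (hprod.indicator hS), ← integral_prod_symm _
    (hprod.indicator hS'), ← integral_add (hprod.indicator hS) (hprod.indicator hS')]
  refine integral_congr_ae ?_
  -- The closed triangles overlap only on the diagonal, which is a null set, so their indicators add
  -- up to 1 almost everywhere.
  have hdiag : ∀ᵐ z ∂(μ.prod μ), z.1 ≠ z.2 := by
    have hm : MeasurableSet {z : ℝ × ℝ | z.1 = z.2} :=
      measurableSet_eq_fun measurable_fst measurable_snd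
    rw [ae_iff]
    simp only [ne_eq, not_not]
    rw [Measure.measure_prod_null hm]
    refine Filter.Eventually.of_forall fun t => ?_
    have : Prod.mk t ⁻¹' {z : ℝ × ℝ | z.1 = z.2} = {t} := by ext; simp [eq_comm]
    simp [this]
  filter_upwards [hdiag] with z hz
  rcases lt_or_gt_of_ne hz with h1 | h1
  · simp [indicator, h1.le, not_le.2 h1]
  · simp [indicator, h1.le, not_le.2 h1]

theorem integrableOn_bilin (B : F →L[ℝ] G →L[ℝ] K) {a b : ℝ} {g : ℝ → F} {v : ℝ → G}
    (hg : IntegrableOn g (Icc a b)) (hv : ContinuousOn v (Icc a b)) :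
    IntegrableOn (fun t => B (g t) (v t)) (Icc a b) := by
  obtain ⟨M, hM⟩ := isCompact_Icc.exists_bound_of_continuousOn hv
  refine (hg.norm.const_mul (‖B‖ * M)).mono' ?_ ?_
  · exact B.aestronglyMeasurable_comp₂ hg.aestronglyMeasurable
      (hv.aestronglyMeasurable measurableSet_Icc)
  · filter_upwards [ae_restrict_mem measurableSet_Icc] with t ht
    refine (B.le_opNorm₂ _ _).trans ?_
    have := hM t ht
    calc ‖B‖ * ‖g t‖ * ‖v t‖ ≤ ‖B‖ * ‖g t‖ * M := by gcongr
      _ = ‖B‖ * M * ‖g t‖ := by ring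

/-- On `[a, b]` the function `u` is a primitive of the integrable function `g`. -/
def IsPrimitive (a b : ℝ) (u g : ℝ → F) : Prop :=
  IntegrableOn g (Ioo a b) ∧ ∀ t ∈ Icc a b, u t = u a + ∫ s in a..t, g s

namespace IsPrimitive

variable {a b : ℝ} {u g : ℝ → F} {v h : ℝ → G}

theorem integrableOn_Icc (H : IsPrimitive a b u g) : IntegrableOn g (Icc a b) := by
  rw [integrableOn_Icc_iff_integrableOn_Ioo]
  exact H.1

theorem intervalIntegrable (H : IsPrimitive a b u g) {c d : ℝ} (hc : c ∈ Icc a b)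
    (hd : d ∈ Icc a b) : IntervalIntegrable g volume c d :=
  (H.integrableOn_Icc.mono_set (uIcc_subset_Icc hc hd)).intervalIntegrable

theorem continuousOn (H : IsPrimitive a b u g) : ContinuousOn u (Icc a b) := by
  rcases lt_or_ge b a with hab | hab
  · simp [Icc_eq_empty_of_lt hab]
  have h1 := intervalIntegral.continuousOn_primitive_interval
    (show IntegrableOn g (uIcc a b) by rw [uIcc_of_le hab]; exact H.integrableOn_Icc)
  rw [uIcc_of_le hab] at h1
  exact (continuousOn_const.add h1).congr H.2

theorem congr (H : IsPrimitive a b u g) {u' g' : ℝ → F} (hab : a ≤ b) (hu : EqOn u' u (Icc a b))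
    (hg : g' =ᵐ[volume.restrict (Ioo a b)] g) : IsPrimitive a b u' g' := by
  refine ⟨H.1.congr hg.symm, fun t ht => ?_⟩
  rw [hu ht, hu (left_mem_Icc.2 hab), H.2 t ht]
  congr 1
  rw [intervalIntegral.integral_of_le ht.1, intervalIntegral.integral_of_le ht.1,
    ← restrict_Ioo_eq_restrict_Ioc]
  exact integral_congr_ae
    (ae_mono (Measure.restrict_mono (Ioo_subset_Ioo_right ht.2) le_rfl) hg.symm)

theorem mono (H : IsPrimitive a b u g) {c d : ℝ} (hac : a ≤ c) (hdb : d ≤ b) :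
    IsPrimitive c d u g := by
  refine ⟨H.1.mono_set (Ioo_subset_Ioo hac hdb), fun t ht => ?_⟩
  have htb := ht.2.trans hdb
  have hcb := ht.1.trans htb
  have hc : c ∈ Icc a b := ⟨hac, hcb⟩
  have ht' : t ∈ Icc a b := ⟨hac.trans ht.1, htb⟩
  have ha : a ∈ Icc a b := ⟨le_rfl, hac.trans hcb⟩
  rw [H.2 t ht', H.2 c hc, add_assoc, intervalIntegral.integral_add_adjacent_intervals
    (H.intervalIntegrable ha hc) (H.intervalIntegrable hc ht')]

theorem integral_eq_sub (H : IsPrimitive a b u g) (hab : a ≤ b) :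
    ∫ t in Ioo a b, g t = u b - u a := by
  rw [H.2 b (right_mem_Icc.2 hab), add_sub_cancel_left, intervalIntegral.integral_of_le hab,
    restrict_Ioo_eq_restrict_Ioc]

theorem of_hasDerivAt [CompleteSpace F] (hu : ContinuousOn u (Icc a b))
    (hd : ∀ t ∈ Ioo a b, HasDerivAt u (g t) t)
    (hg : IntegrableOn g (Ioo a b)) : IsPrimitive a b u g := by
  refine ⟨hg, fun t ht => ?_⟩
  have hg' : IntegrableOn g (Icc a b) := by
    rwa [integrableOn_Icc_iff_integrableOn_Ioo]
  rw [intervalIntegral.integral_eq_sub_of_hasDeriv_right]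
  · abel
  · rw [uIcc_of_le ht.1]; exact hu.mono (Icc_subset_Icc_right ht.2)
  · intro s hs
    rw [min_eq_left ht.1, max_eq_right ht.1] at hs
    exact (hd s ⟨hs.1, hs.2.trans_le ht.2⟩).hasDerivWithinAt
  · rw [intervalIntegrable_iff_integrableOn_Icc_of_le ht.1]
    exact hg'.mono_set (Icc_subset_Icc_right ht.2)

theorem of_contDiff [CompleteSpace F] (hu : ContDiff ℝ 1 u) : IsPrimitive a b u (deriv u) :=
  of_hasDerivAt hu.continuous.continuousOn
    (fun t _ => (hu.differentiable one_ne_zero t).hasDerivAt)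
    (((hu.continuous_deriv le_rfl).continuousOn.integrableOn_Icc).mono_set Ioo_subset_Icc_self)

/-- The product rule, for a general bilinear map so that it covers both scalar multiplication and
the inner product. Splitting off the initial values u(a) and v(a) leaves exactly the two integrals
of `integral_bilin_add_integral_bilin`. -/
theorem bilin [CompleteSpace F] [CompleteSpace G] [CompleteSpace K] (B : F →L[ℝ] G →L[ℝ] K)
    (H : IsPrimitive a b u g) (H' : IsPrimitive a b v h) :
    IsPrimitive a b (fun t => B (u t) (v t)) (fun t => B (g t) (v t) + B (u t) (h t)) := by
  have hi1 : IntegrableOn (fun t => B (g t) (v t)) (Icc a b) :=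
    (integrableOn_bilin B H.integrableOn_Icc H'.continuousOn)
  have hi2 : IntegrableOn (fun t => B (u t) (h t)) (Icc a b) :=
    (integrableOn_bilin B.flip H'.integrableOn_Icc H.continuousOn)
  refine ⟨(hi1.add hi2).mono_set Ioo_subset_Icc_self, fun t ht => ?_⟩
  have hsub : Ioc a t ⊆ Icc a b := fun s hs => ⟨hs.1.le, hs.2.trans ht.2⟩
  have hgt := H.integrableOn_Icc.mono_set hsub
  have hht := H'.integrableOn_Icc.mono_set hsub
  have key := integral_bilin_add_integral_bilin B ht.1 hgt hht
  rw [intervalIntegral.integral_of_le ht.1, integral_add (hi1.mono_set hsub) (hi2.mono_set hsub)]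
  have e1 : ∫ s in Ioc a t, B (g s) (v s) =
      B (∫ s in a..t, g s) (v a) + ∫ s in Ioc a t, B (g s) (∫ r in a..s, h r) := by
    have : ∀ s ∈ Ioc a t, B (g s) (v s) = B.flip (v a) (g s) + B (g s) (∫ r in a..s, h r) :=
      fun s hs => by rw [H'.2 s (hsub hs), map_add]; rfl
    rw [setIntegral_congr_fun measurableSet_Ioc this, integral_add,
      ContinuousLinearMap.integral_comp_comm _ hgt, intervalIntegral.integral_of_le ht.1]
    · rfl
    · exact (B.flip (v a)).integrable_comp hgt
    · refine ((hi1.mono_set hsub).sub ((B.flip (v a)).integrable_comp hgt)).congr ?_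
      filter_upwards [ae_restrict_mem measurableSet_Ioc] with s hs
      simp only [Pi.sub_apply]
      rw [this s hs, add_sub_cancel_left]
  have e2 : ∫ s in Ioc a t, B (u s) (h s) =
      B (u a) (∫ s in a..t, h s) + ∫ s in Ioc a t, B (∫ r in a..s, g r) (h s) := by
    have : ∀ s ∈ Ioc a t, B (u s) (h s) = B (u a) (h s) + B (∫ r in a..s, g r) (h s) :=
      fun s hs => by rw [H.2 s (hsub hs), map_add]; rfl
    rw [setIntegral_congr_fun measurableSet_Ioc this, integral_add,
      ContinuousLinearMap.integral_comp_comm _ hht, intervalIntegral.integral_of_le ht.1]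
    · exact (B (u a)).integrable_comp hht
    · refine ((hi2.mono_set hsub).sub ((B (u a)).integrable_comp hht)).congr ?_
      filter_upwards [ae_restrict_mem measurableSet_Ioc] with s hs
      simp only [Pi.sub_apply]
      rw [this s hs, add_sub_cancel_left]
  simp only
  rw [e1, e2, H.2 t ht, H'.2 t ht]
  simp only [map_add, add_apply, ← key]
  abel

end IsPrimitive

end Primitive

/-! ### Weak derivatives and primitives -/

section WeakDeriv

variable {E : Type*} [NormedAddCommGroup E] [InnerProductSpace ℝ E]

theorem exists_subset_Icc_of_isCompact {a b : ℝ} (hab : a < b) {S : Set ℝ} (hS : IsCompact S)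
    (hSab : S ⊆ Ioo a b) : ∃ c d, a < c ∧ d < b ∧ S ⊆ Icc c d := by
  rcases S.eq_empty_or_nonempty with rfl | hne
  · exact ⟨(a + b) / 2, (a + b) / 2, by linarith, by linarith, empty_subset _⟩
  obtain ⟨c, hc⟩ := hS.exists_isLeast hne
  obtain ⟨d, hd⟩ := hS.exists_isGreatest hne
  exact ⟨c, d, (hSab hc.1).1, (hSab hd.1).2, fun s hs => ⟨hc.2 hs, hd.2 hs⟩⟩

/-- A test function with mean zero is the derivative of a test function. -/
theorem exists_testFunction_deriv_eq {a b : ℝ} (hab : a < b) {η : ℝ → ℝ} (hη : ContDiff ℝ ∞ η)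
    (hc : HasCompactSupport η) (hs : tsupport η ⊆ Ioo a b) (h0 : ∫ t in Ioo a b, η t = 0) :
    ∃ ζ : ℝ → ℝ, ContDiff ℝ ∞ ζ ∧ HasCompactSupport ζ ∧ tsupport ζ ⊆ Ioo a b ∧ deriv ζ = η := by
  obtain ⟨c, d, hac, hdb, hcd⟩ := exists_subset_Icc_of_isCompact hab hc hs
  have hz : ∀ t, t ∉ Icc c d → η t = 0 := fun t ht =>
    image_eq_zero_of_notMem_tsupport fun h => ht (hcd h)
  have hint : ∀ x y, IntervalIntegrable η volume x y := fun x y =>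
    hη.continuous.intervalIntegrable x y
  have hd : ∀ t, HasDerivAt (fun t => ∫ s in a..t, η s) (η t) t := fun t =>
    intervalIntegral.integral_hasDerivAt_right (hint a t)
      (hη.continuous.stronglyMeasurableAtFilter _ _) hη.continuous.continuousAt
  have hderiv : deriv (fun t => ∫ s in a..t, η s) = η := funext fun t => (hd t).deriv
  have hsupp : Function.support (fun t => ∫ s in a..t, η s) ⊆ Icc c d := by
    intro t ht
    by_contra hn
    apply ht
    rw [mem_Icc, not_and_or, not_le, not_le] at hn
    simp only
    rcases hn with hn | hn
    · refine intervalIntegral.integral_zero_ae (Filter.Eventually.of_forall fun s hs => hz s ?_)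
      intro h
      rcases le_total a t with h' | h'
      · rw [uIoc_of_le h'] at hs
        linarith [h.1, hs.2]
      · rw [uIoc_of_ge h'] at hs
        linarith [h.1, hs.2]
    -- The zero mean is what makes the primitive vanish to the right of the support. Since t may lie
    -- on either side of b, the remaining integral is controlled by d < min b t.
    · have e : ∫ s in a..b, η s = 0 := by
        rw [intervalIntegral.integral_of_le hab.le, ← restrict_Ioo_eq_restrict_Ioc, h0]
      rw [← intervalIntegral.integral_add_adjacent_intervals (hint a b) (hint b t), e, zero_add]
      refine intervalIntegral.integral_zero_ae (Filter.Eventually.of_forall fun s hs => hz s ?_)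
      intro h
      have := (uIoc_subset_uIcc hs).1
      have h2 : d < min b t := lt_min hdb hn
      exact absurd (this.trans h.2) (not_le.2 h2)
  have hts : tsupport (fun t => ∫ s in a..t, η s) ⊆ Icc c d :=
    closure_minimal hsupp isClosed_Icc
  refine ⟨fun t => ∫ s in a..t, η s, ?_, isCompact_Icc.of_isClosed_subset (isClosed_tsupport _) hts,
    hts.trans fun t ht => ⟨hac.trans_le ht.1, ht.2.trans_lt hdb⟩, hderiv⟩
  rw [contDiff_infty_iff_deriv, hderiv]
  exact ⟨fun t => (hd t).differentiableAt, hη⟩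

theorem ae_eq_zero_of_forall_testFunction [CompleteSpace E] {a b : ℝ} {f : ℝ → E}
    (hf : IntegrableOn f (Ioo a b))
    (h : ∀ η : ℝ → ℝ, ContDiff ℝ ∞ η → HasCompactSupport η → tsupport η ⊆ Ioo a b →
      ∫ θ in Ioo a b, η θ • f θ = 0) :
    f =ᵐ[volume.restrict (Ioo a b)] 0 := by
  have key := isOpen_Ioo.ae_eq_zero_of_integral_contDiff_smul_eq_zero (U := Ioo a b)
    hf.locallyIntegrableOn fun η hη hc hs => by
      rw [← h η hη hc hs, setIntegral_eq_integral_of_forall_compl_eq_zero]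
      intro θ hθ
      rw [image_eq_zero_of_notMem_tsupport fun h => hθ (hs h), zero_smul]
  rw [← ae_restrict_iff' measurableSet_Ioo] at key
  exact key

theorem exists_testFunction_integral_eq_one {a b : ℝ} (hab : a < b) :
    ∃ η : ℝ → ℝ, ContDiff ℝ ∞ η ∧ HasCompactSupport η ∧ tsupport η ⊆ Ioo a b ∧
      ∫ t in Ioo a b, η t = 1 := by
  let φ : ContDiffBump ((a + b) / 2) := ⟨(b - a) / 8, (b - a) / 4, by linarith, by linarith⟩
  have hts : tsupport (φ.normed volume) ⊆ Ioo a b := by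
    rw [φ.tsupport_normed_eq]
    intro t ht
    rw [Metric.mem_closedBall, Real.dist_eq, abs_le] at ht
    have h1 : φ.rOut = (b - a) / 4 := rfl
    rw [h1] at ht
    constructor <;> linarith [ht.1, ht.2]
  refine ⟨φ.normed volume, φ.contDiff_normed, φ.hasCompactSupport_normed, hts, ?_⟩
  rw [setIntegral_eq_integral_of_forall_compl_eq_zero, φ.integral_normed]
  intro t ht
  exact image_eq_zero_of_notMem_tsupport fun h => ht (hts h)

theorem integrableOn_continuous_smul {a b : ℝ} {η : ℝ → ℝ} (hη : Continuous η) {f : ℝ → E}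
    (hf : IntegrableOn f (Ioo a b)) : IntegrableOn (fun t => η t • f t) (Ioo a b) := by
  have := integrableOn_bilin (ContinuousLinearMap.lsmul ℝ ℝ).flip (a := a) (b := b) (g := f)
    (by rwa [integrableOn_Icc_iff_integrableOn_Ioo]) hη.continuousOn
  exact this.mono_set Ioo_subset_Icc_self

/-- A function whose weak derivative vanishes is constant. -/
theorem exists_ae_eq_const_of_hasWeakDeriv_zero [CompleteSpace E] {a b : ℝ} (hab : a < b)
    {f : ℝ → E} (hf : IntegrableOn f (Ioo a b)) (h : HasWeakDeriv a b f 0) :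
    ∃ c : E, f =ᵐ[volume.restrict (Ioo a b)] fun _ => c := by
  obtain ⟨η₀, hη₀, hc₀, hs₀, h1⟩ := exists_testFunction_integral_eq_one hab
  have hiη : ∀ {η : ℝ → ℝ}, Continuous η → IntegrableOn η (Ioo a b) := fun hη =>
    hη.continuousOn.integrableOn_Icc.mono_set Ioo_subset_Icc_self
  -- The constant is the average of f against the normalized bump η₀. For a test function η of mean
  -- m, η - m η₀ has mean zero, hence is the derivative of a test function and is annihilated by f.
  set c := ∫ t in Ioo a b, η₀ t • f t with hcdef
  refine ⟨c, ?_⟩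
  have key : (fun t => f t - c) =ᵐ[volume.restrict (Ioo a b)] 0 := by
    have hcint : IntegrableOn (fun _ : ℝ => c) (Ioo a b) := by simp
    refine ae_eq_zero_of_forall_testFunction (hf.sub hcint) fun η hη hc hs => ?_
    set m := ∫ t in Ioo a b, η t with hm
    have hηm : ContDiff ℝ ∞ (fun t => η t - m * η₀ t) := hη.sub (contDiff_const.mul hη₀)
    have hcm : HasCompactSupport (fun t => η t - m * η₀ t) :=
      hc.sub (hc₀.mul_left (f := fun _ => m))
    have hsm' : tsupport (fun t => η t - m * η₀ t) ⊆ Ioo a b := by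
      have h2 : tsupport (fun t => η t - m * η₀ t) ⊆ tsupport η ∪ tsupport η₀ := by
        refine closure_minimal (fun t ht => ?_) ((isClosed_tsupport _).union (isClosed_tsupport _))
        by_contra hn
        rw [mem_union, not_or] at hn
        apply ht
        simp [image_eq_zero_of_notMem_tsupport hn.1, image_eq_zero_of_notMem_tsupport hn.2]
      exact h2.trans (union_subset hs hs₀)
    obtain ⟨ζ, hζ, hcζ, hsζ, hdζ⟩ := exists_testFunction_deriv_eq hab hηm hcm hsm' (by
      rw [integral_sub (hiη hη.continuous) ((hiη hη₀.continuous).const_mul m),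
        integral_const_mul, h1, mul_one, sub_self])
    have h3 := h ζ hζ hcζ hsζ
    simp only [hdζ, Pi.zero_apply, smul_zero, integral_zero, neg_zero] at h3
    simp only [sub_smul, mul_smul] at h3
    rw [integral_sub (integrableOn_continuous_smul hη.continuous hf)
      (g := fun t => m • η₀ t • f t) ((integrableOn_continuous_smul hη₀.continuous hf).smul m),
      integral_smul] at h3
    simp only [smul_sub]
    rw [integral_sub (integrableOn_continuous_smul hη.continuous hf)
      ((hiη hη.continuous).smul_const c), integral_smul_const]
    exact h3
  filter_upwards [key] with t ht
  exact sub_eq_zero.1 ht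

variable {a b : ℝ} {u g : ℝ → E}

theorem IsPrimitive.hasWeakDeriv [CompleteSpace E] (hab : a ≤ b) (H : IsPrimitive a b u g) :
    HasWeakDeriv a b u g := by
  intro η hη hc hs
  have hη1 : IsPrimitive a b η (deriv η) := .of_contDiff (hη.of_le (by simp))
  have h1 := (hη1.bilin (ContinuousLinearMap.lsmul ℝ ℝ) H).integral_eq_sub hab
  have hz : ∀ t, t ∉ Ioo a b → η t = 0 := fun t ht =>
    image_eq_zero_of_notMem_tsupport fun h => ht (hs h)
  simp only [ContinuousLinearMap.lsmul_apply] at h1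
  rw [hz a (by simp), hz b (by simp), integral_add] at h1
  · simpa [add_eq_zero_iff_eq_neg] using h1
  · exact (integrableOn_bilin (ContinuousLinearMap.lsmul ℝ ℝ) hη1.integrableOn_Icc
      H.continuousOn).mono_set Ioo_subset_Icc_self
  · exact (integrableOn_bilin (ContinuousLinearMap.lsmul ℝ ℝ).flip H.integrableOn_Icc
      hη1.continuousOn).mono_set Ioo_subset_Icc_self

/-- An integrable function with an integrable weak derivative `g` is almost everywhere equal to a
primitive of `g`. -/
theorem HasWeakDeriv.exists_isPrimitive [CompleteSpace E] (hab : a < b)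
    (hu : IntegrableOn u (Ioo a b)) (hg : IntegrableOn g (Ioo a b)) (h : HasWeakDeriv a b u g) :
    ∃ w, IsPrimitive a b w g ∧ u =ᵐ[volume.restrict (Ioo a b)] w := by
  have H0 : IsPrimitive a b (fun t => ∫ s in a..t, g s) g := ⟨hg, fun t _ => by simp⟩
  have hi0 : IntegrableOn (fun t => ∫ s in a..t, g s) (Ioo a b) :=
    H0.continuousOn.integrableOn_Icc.mono_set Ioo_subset_Icc_self
  obtain ⟨c, hc⟩ := exists_ae_eq_const_of_hasWeakDeriv_zero hab (hu.sub hi0) (by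
    intro η hη hcη hs
    have hη' : Continuous (deriv η) := hη.continuous_deriv (by simp)
    simp only [Pi.sub_apply, smul_sub]
    rw [integral_sub (integrableOn_continuous_smul hη' hu)
      (integrableOn_continuous_smul hη' hi0), h η hη hcη hs,
      H0.hasWeakDeriv hab.le η hη hcη hs]
    simp)
  refine ⟨fun t => c + ∫ s in a..t, g s, ⟨hg, fun t _ => by simp⟩, ?_⟩
  filter_upwards [hc] with t ht
  rw [← ht]
  simp

/-- Continuity upgrades the almost-everywhere equality with a primitive to equality on the closed
interval, so that boundary values make sense. -/
theorem HasWeakDeriv.isPrimitive [CompleteSpace E] (hab : a < b)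
    (hu : ContinuousOn u (Icc a b)) (hg : IntegrableOn g (Ioo a b)) (h : HasWeakDeriv a b u g) :
    IsPrimitive a b u g := by
  obtain ⟨w, hw, hae⟩ := h.exists_isPrimitive hab
    (hu.integrableOn_Icc.mono_set Ioo_subset_Icc_self) hg
  refine hw.congr hab.le ?_ (ae_eq_refl _)
  refine Measure.eqOn_Icc_of_ae_eq volume hab.ne ?_ hu hw.continuousOn
  rwa [← restrict_Ioo_eq_restrict_Icc]

end WeakDeriv

/-! ### Partitions -/

namespace DelayPartition

variable {J : ℕ} (P : DelayPartition J)

theorem left_lt_right (j : Fin (J + 1)) : P.left j < P.right j :=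
  neg_lt_neg (P.strictMono Fin.castSucc_lt_succ)

theorem neg_delay_le_left (j : Fin (J + 1)) : -P.delay ≤ P.left j :=
  neg_le_neg (P.strictMono.monotone (Fin.le_last _))

theorem right_nonpos (j : Fin (J + 1)) : P.right j ≤ 0 := by
  rw [right, neg_nonpos, ← P.τ_zero]
  exact P.strictMono.monotone (Fin.zero_le _)

theorem right_zero : P.right 0 = 0 := by simp [right, P.τ_zero]

theorem left_last : P.left (Fin.last J) = -P.delay := rfl

theorem left_castSucc (j : Fin J) : P.left j.castSucc = P.node j := by
  rw [left, node, Fin.succ_castSucc]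

theorem right_succ (j : Fin J) : P.right j.succ = P.node j := rfl

theorem neg_delay_lt_zero : -P.delay < 0 := neg_lt_zero.2 P.delay_pos

theorem segment_subset (j : Fin (J + 1)) : Ioo (P.left j) (P.right j) ⊆ Ioo (-P.delay) 0 :=
  Ioo_subset_Ioo (P.neg_delay_le_left j) (P.right_nonpos j)

theorem right_le_left {i j : Fin (J + 1)} (h : i < j) : P.right j ≤ P.left i :=
  neg_le_neg (P.strictMono.monotone (Fin.le_castSucc_iff.2 (by simpa using h)))

theorem iUnion_Ioc : ⋃ j, Ioc (P.left j) (P.right j) = Ioc (-P.delay) 0 := by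
  refine Subset.antisymm (iUnion_subset fun j =>
    Ioc_subset_Ioc (P.neg_delay_le_left j) (P.right_nonpos j)) fun θ hθ => ?_
  by_contra hn
  simp only [mem_iUnion, mem_Ioc, not_exists, not_and, not_le] at hn
  have key : ∀ i : Fin (J + 2), θ ≤ -P.τ i := by
    refine Fin.induction ?_ ?_
    · rw [P.τ_zero]
      linarith [hθ.2]
    · intro i hi
      by_contra hc
      exact absurd hi (not_le.2 (hn i (not_le.1 hc)))
  exact absurd (key (Fin.last (J + 1))) (not_le.2 hθ.1)

/-- The segments tile the interval up to null sets. Almost-everywhere statements, integrability and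
integrals are all reduced to single segments through this identity. -/
theorem volume_restrict_eq_sum : volume.restrict (Ioo (-P.delay) 0) =
    ∑ j, volume.restrict (Ioo (P.left j) (P.right j)) := by
  rw [restrict_Ioo_eq_restrict_Ioc, ← P.iUnion_Ioc, Measure.restrict_iUnion, Measure.sum_fintype]
  · simp only [restrict_Ioo_eq_restrict_Ioc]
  · intro i j hij
    rcases lt_or_gt_of_ne hij with h | h
    · exact (disjoint_left.2 fun θ h1 h2 => absurd (h2.2.trans (P.right_le_left h)) (not_le.2 h1.1))
    · exact (disjoint_left.2 fun θ h1 h2 => absurd (h1.2.trans (P.right_le_left h)) (not_le.2 h2.1))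
  · exact fun _ => measurableSet_Ioc

theorem ae_restrict_iff {p : ℝ → Prop} : (∀ᵐ θ ∂volume.restrict (Ioo (-P.delay) 0), p θ) ↔
    ∀ j, ∀ᵐ θ ∂volume.restrict (Ioo (P.left j) (P.right j)), p θ := by
  rw [P.volume_restrict_eq_sum, ← Measure.sum_fintype, Measure.ae_sum_iff]

theorem integrableOn_iff {F : Type*} [NormedAddCommGroup F] {f : ℝ → F} :
    IntegrableOn f (Ioo (-P.delay) 0) ↔ ∀ j, IntegrableOn f (Ioo (P.left j) (P.right j)) := by
  rw [IntegrableOn, P.volume_restrict_eq_sum, integrable_finsetSum_measure]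
  simp [IntegrableOn]

theorem integral_eq_sum {F : Type*} [NormedAddCommGroup F] [NormedSpace ℝ F] {f : ℝ → F}
    (hf : IntegrableOn f (Ioo (-P.delay) 0)) :
    ∫ θ in Ioo (-P.delay) 0, f θ = ∑ j, ∫ θ in Ioo (P.left j) (P.right j), f θ := by
  rw [P.volume_restrict_eq_sum, integral_finsetSum_measure]
  exact fun j _ => P.integrableOn_iff.1 hf j

theorem aemeasurable_of_segments {β : Type*} [MeasurableSpace β] {f : ℝ → β}
    (hf : ∀ j, AEMeasurable f (volume.restrict (Ioo (P.left j) (P.right j)))) :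
    AEMeasurable f (volume.restrict (Ioo (-P.delay) 0)) := by
  rw [P.volume_restrict_eq_sum, ← Measure.sum_fintype]
  exact aemeasurable_sum_measure_iff.2 hf

end DelayPartition

/-- Regrouping of boundary terms. Segments are numbered from right to left, so the left end of
segment i is the right end of segment i + 1; the two contributions there combine into a jump, and
only the outer ends remain. -/
theorem sum_segments_eq {J : ℕ} (R L : Fin (J + 1) → ℝ) :
    ∑ j, (R j - L j) = R 0 - L (Fin.last J) - ∑ i : Fin J, (L i.castSucc - R i.succ) := by
  rw [Finset.sum_sub_distrib, Finset.sum_sub_distrib, Fin.sum_univ_succ, Fin.sum_univ_castSucc]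
  ring

/-! ### One-sided limits at the ends of a segment -/

section Lim

variable {F : Type*} [TopologicalSpace F] {v r : ℝ → F} {a b : ℝ}

theorem tendsto_left_end (hab : a < b) (hr : ContinuousOn r (Icc a b)) (h : EqOn v r (Ioo a b)) :
    Filter.Tendsto v (nhdsWithin a (Ioi a)) (nhds (r a)) := by
  have h1 : Filter.Tendsto r (nhdsWithin a (Ioo a b)) (nhds (r a)) :=
    (hr a (left_mem_Icc.2 hab.le)).mono_left (nhdsWithin_mono _ Ioo_subset_Icc_self)
  rw [nhdsWithin_Ioo_eq_nhdsGT hab] at h1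
  refine h1.congr' ?_
  filter_upwards [Ioo_mem_nhdsGT hab] with t ht using (h ht).symm

theorem tendsto_right_end (hab : a < b) (hr : ContinuousOn r (Icc a b)) (h : EqOn v r (Ioo a b)) :
    Filter.Tendsto v (nhdsWithin b (Iio b)) (nhds (r b)) := by
  have h1 : Filter.Tendsto r (nhdsWithin b (Ioo a b)) (nhds (r b)) :=
    (hr b (right_mem_Icc.2 hab.le)).mono_left (nhdsWithin_mono _ Ioo_subset_Icc_self)
  rw [nhdsWithin_Ioo_eq_nhdsLT hab] at h1
  refine h1.congr' ?_
  filter_upwards [Ioo_mem_nhdsLT hab] with t ht using (h ht).symm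

variable [T2Space F]

theorem rightLim_eq_of_eqOn (hab : a < b) (hr : ContinuousOn r (Icc a b)) (h : EqOn v r (Ioo a b)) :
    Function.rightLim v a = r a :=
  rightLim_eq_of_tendsto (tendsto_left_end hab hr h)

theorem leftLim_eq_of_eqOn (hab : a < b) (hr : ContinuousOn r (Icc a b)) (h : EqOn v r (Ioo a b)) :
    Function.leftLim v b = r b :=
  leftLim_eq_of_tendsto (tendsto_right_end hab hr h)

end Lim

/-! ### Weights -/

namespace Weight

variable {J : ℕ} {P : DelayPartition J} (W : Weight P)

/-- The weight extended by continuity from the `j`-th open segment to the closed one. -/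
def rep (j : Fin (J + 1)) : ℝ → ℝ := (W.contDiff j).choose

theorem contDiffOn_rep (j : Fin (J + 1)) : ContDiffOn ℝ 1 (W.rep j) (Icc (P.left j) (P.right j)) :=
  (W.contDiff j).choose_spec.1

theorem eqOn_rep (j : Fin (J + 1)) : EqOn W.ρ (W.rep j) (Ioo (P.left j) (P.right j)) :=
  (W.contDiff j).choose_spec.2

theorem continuousOn_rep (j : Fin (J + 1)) : ContinuousOn (W.rep j) (Icc (P.left j) (P.right j)) :=
  (W.contDiffOn_rep j).continuousOn

/-- The lower bound passes from the open segment to its closure by continuity of the representative;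
the values of ρ at the nodes themselves play no role. -/
theorem exists_le_rep : ∃ c : ℝ, 0 < c ∧ ∀ j, ∀ θ ∈ Icc (P.left j) (P.right j), c ≤ W.rep j θ := by
  obtain ⟨c, hc, h⟩ := W.pos
  refine ⟨c, hc, fun j θ hθ => ?_⟩
  rw [← closure_Ioo (P.left_lt_right j).ne] at hθ
  refine le_on_closure (f := fun _ => c) (g := W.rep j) (s := Ioo (P.left j) (P.right j)) ?_
    continuousOn_const ?_ hθ
  · intro t ht
    rw [← W.eqOn_rep j ht]
    exact h t (Ioo_subset_Icc_self (P.segment_subset j ht))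
  · rw [closure_Ioo (P.left_lt_right j).ne]
    exact W.continuousOn_rep j

theorem rep_pos (j : Fin (J + 1)) {θ : ℝ} (hθ : θ ∈ Icc (P.left j) (P.right j)) :
    0 < W.rep j θ := by
  obtain ⟨c, hc, h⟩ := W.exists_le_rep
  exact hc.trans_le (h j θ hθ)

theorem pos_of_mem {θ : ℝ} (hθ : θ ∈ Icc (-P.delay) 0) : 0 < W.ρ θ := by
  obtain ⟨c, hc, h⟩ := W.pos
  exact hc.trans_le (h θ hθ)

theorem rightLim_left (j : Fin (J + 1)) :
    Function.rightLim W.ρ (P.left j) = W.rep j (P.left j) :=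
  rightLim_eq_of_eqOn (P.left_lt_right j) (W.continuousOn_rep j) (W.eqOn_rep j)

theorem leftLim_right (j : Fin (J + 1)) :
    Function.leftLim W.ρ (P.right j) = W.rep j (P.right j) :=
  leftLim_eq_of_eqOn (P.left_lt_right j) (W.continuousOn_rep j) (W.eqOn_rep j)

theorem rightLim_neg_delay_pos : 0 < Function.rightLim W.ρ (-P.delay) := by
  rw [← P.left_last, W.rightLim_left]
  exact W.rep_pos _ (left_mem_Icc.2 (P.left_lt_right _).le)

theorem hasDerivAt_rep (j : Fin (J + 1)) {θ : ℝ} (hθ : θ ∈ Ioo (P.left j) (P.right j)) :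
    HasDerivAt (W.rep j) (deriv W.ρ θ) θ := by
  have hn : Icc (P.left j) (P.right j) ∈ nhds θ := Icc_mem_nhds hθ.1 hθ.2
  have hd : DifferentiableAt ℝ (W.rep j) θ :=
    ((W.contDiffOn_rep j).differentiableOn one_ne_zero).differentiableAt hn
  have he : W.ρ =ᶠ[nhds θ] W.rep j := by
    filter_upwards [Ioo_mem_nhds hθ.1 hθ.2] with t ht using W.eqOn_rep j ht
  rw [he.deriv_eq]
  exact hd.hasDerivAt

/-- Identifies ρ' with a function continuous up to the ends of the segment, which makes it bounded
and integrable there by compactness. -/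
theorem deriv_eq_derivWithin (j : Fin (J + 1)) {θ : ℝ} (hθ : θ ∈ Ioo (P.left j) (P.right j)) :
    deriv W.ρ θ = derivWithin (W.rep j) (Icc (P.left j) (P.right j)) θ := by
  rw [derivWithin_of_mem_nhds (Icc_mem_nhds hθ.1 hθ.2), (W.hasDerivAt_rep j hθ).deriv]

theorem continuousOn_derivWithin_rep (j : Fin (J + 1)) :
    ContinuousOn (derivWithin (W.rep j) (Icc (P.left j) (P.right j)))
      (Icc (P.left j) (P.right j)) :=
  (W.contDiffOn_rep j).continuousOn_derivWithin (uniqueDiffOn_Icc (P.left_lt_right j)) le_rfl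

theorem integrableOn_deriv (j : Fin (J + 1)) :
    IntegrableOn (deriv W.ρ) (Ioo (P.left j) (P.right j)) :=
  ((W.continuousOn_derivWithin_rep j).integrableOn_Icc.mono_set Ioo_subset_Icc_self).congr_fun
    (fun _ hθ => (W.deriv_eq_derivWithin j hθ).symm) measurableSet_Ioo

theorem isPrimitive_rep (j : Fin (J + 1)) :
    IsPrimitive (P.left j) (P.right j) (W.rep j) (deriv W.ρ) :=
  .of_hasDerivAt (W.continuousOn_rep j) (fun _ hθ => W.hasDerivAt_rep j hθ) (W.integrableOn_deriv j)

/-- Needed to pass from Sobolev regularity of ρψ, which is what testing yields, to that of ψ. -/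
theorem isPrimitive_inv_rep (j : Fin (J + 1)) :
    IsPrimitive (P.left j) (P.right j) (fun θ => (W.rep j θ)⁻¹)
      (fun θ => -deriv W.ρ θ / (W.ρ θ) ^ 2) := by
  have hne : ∀ θ ∈ Icc (P.left j) (P.right j), W.rep j θ ≠ 0 := fun θ hθ => (W.rep_pos j hθ).ne'
  refine .of_hasDerivAt ((W.continuousOn_rep j).inv₀ hne) (fun θ hθ => ?_) ?_
  · have := (W.hasDerivAt_rep j hθ).fun_inv (hne θ (Ioo_subset_Icc_self hθ))
    rwa [W.eqOn_rep j hθ]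
  · have : ContinuousOn (fun θ => -derivWithin (W.rep j) (Icc (P.left j) (P.right j)) θ /
        (W.rep j θ) ^ 2) (Icc (P.left j) (P.right j)) :=
      (W.continuousOn_derivWithin_rep j).neg.div ((W.continuousOn_rep j).pow 2)
        fun θ hθ => pow_ne_zero 2 (hne θ hθ)
    refine (this.integrableOn_Icc.mono_set Ioo_subset_Icc_self).congr_fun
      (fun θ hθ => ?_) measurableSet_Ioo
    simp only [W.deriv_eq_derivWithin j hθ, W.eqOn_rep j hθ]

theorem aemeasurable_deriv : AEMeasurable (deriv W.ρ) (volume.restrict (Ioo (-P.delay) 0)) :=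
  P.aemeasurable_of_segments fun j => (W.integrableOn_deriv j).aemeasurable

theorem exists_bound_deriv : ∃ K, ∀ᵐ θ ∂volume.restrict (Ioo (-P.delay) 0), ‖deriv W.ρ θ‖ ≤ K := by
  choose K hK using fun j => isCompact_Icc.exists_bound_of_continuousOn
    (W.continuousOn_derivWithin_rep j)
  refine ⟨∑ j, |K j|, P.ae_restrict_iff.2 fun j => ?_⟩
  filter_upwards [ae_restrict_mem measurableSet_Ioo] with θ hθ
  rw [W.deriv_eq_derivWithin j hθ]
  exact ((hK j θ (Ioo_subset_Icc_self hθ)).trans (le_abs_self _)).trans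
    (Finset.single_le_sum (f := fun j => |K j|) (fun i _ => abs_nonneg _) (Finset.mem_univ j))

theorem exists_bound : ∃ K, ∀ᵐ θ ∂volume.restrict (Ioo (-P.delay) 0), ‖W.ρ θ‖ ≤ K := by
  choose K hK using fun j => isCompact_Icc.exists_bound_of_continuousOn (W.continuousOn_rep j)
  refine ⟨∑ j, |K j|, P.ae_restrict_iff.2 fun j => ?_⟩
  filter_upwards [ae_restrict_mem measurableSet_Ioo] with θ hθ
  rw [W.eqOn_rep j hθ]
  exact ((hK j θ (Ioo_subset_Icc_self hθ)).trans (le_abs_self _)).trans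
    (Finset.single_le_sum (f := fun j => |K j|) (fun i _ => abs_nonneg _) (Finset.mem_univ j))

theorem exists_bound_inv : ∃ K, ∀ᵐ θ ∂volume.restrict (Ioo (-P.delay) 0), ‖(W.ρ θ)⁻¹‖ ≤ K := by
  obtain ⟨c, hc, h⟩ := W.pos
  refine ⟨c⁻¹, ?_⟩
  filter_upwards [ae_restrict_mem measurableSet_Ioo] with θ hθ
  have h1 := h θ (Ioo_subset_Icc_self hθ)
  rw [norm_inv, Real.norm_of_nonneg (hc.le.trans h1)]
  exact inv_anti₀ hc h1

variable {F : Type*} [NormedAddCommGroup F]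

/-- Since ρ is bounded above and away from zero, the weighted and the unweighted L₂ spaces have the
same elements. -/
theorem memLp_measure_iff {f : ℝ → F} :
    MemLp f 2 W.measure ↔ MemLp f 2 (volume.restrict (Ioo (-P.delay) 0)) := by
  refine ⟨fun h => ?_, fun h => ?_⟩
  · obtain ⟨c, hc, hle⟩ := W.exists_volume_le
    exact h.of_measure_le_smul hc hle
  · obtain ⟨K, hK⟩ := W.exists_bound
    refine h.of_measure_le_smul (c := ENNReal.ofReal K) ENNReal.ofReal_ne_top ?_
    rw [measure, ← withDensity_const]
    refine withDensity_mono ?_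
    filter_upwards [hK] with θ hθ
    exact ENNReal.ofReal_le_ofReal ((le_abs_self _).trans hθ)

theorem ae_measure_iff {p : ℝ → Prop} :
    (∀ᵐ θ ∂W.measure, p θ) ↔ ∀ᵐ θ ∂volume.restrict (Ioo (-P.delay) 0), p θ :=
  ⟨fun h => W.volume_absolutelyContinuous.ae_le h, fun h => W.absolutelyContinuous_volume.ae_le h⟩

end Weight

theorem memLp_smul_of_bound {F : Type*} [NormedAddCommGroup F] [NormedSpace ℝ F] {μ : Measure ℝ}
    {a : ℝ → ℝ} {f : ℝ → F} (ha : AEMeasurable a μ)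
    (hK : ∃ K, ∀ᵐ θ ∂μ, ‖a θ‖ ≤ K) (hf : MemLp f 2 μ) : MemLp (fun θ => a θ • f θ) 2 μ := by
  obtain ⟨K, hK⟩ := hK
  exact hf.smul (memLp_top_of_bound ha.aestronglyMeasurable K hK)

/-! ### Integration by parts over the partition -/

section Green

variable {E : Type*} [NormedAddCommGroup E] [InnerProductSpace ℝ E] [CompleteSpace E]
  {J : ℕ} {P : DelayPartition J}

/-- Replaces the weak formulation on a segment by an honest primitive on its closure, to which the
product rule applies. -/
theorem IsPiecewiseSobolev.exists_rep {ψ v g : ℝ → E} (h : IsPiecewiseSobolev P ψ v g)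
    (j : Fin (J + 1)) : ∃ r, IsPrimitive (P.left j) (P.right j) r g ∧
      EqOn v r (Ioo (P.left j) (P.right j)) ∧
      ψ =ᵐ[volume.restrict (Ioo (P.left j) (P.right j))] r := by
  obtain ⟨h1, ⟨r, hr, he⟩, h3⟩ := h.2 j
  have hg : IntegrableOn g (Ioo (P.left j) (P.right j)) :=
    IntegrableOn.mono_set (h.1.integrable one_le_two) (P.segment_subset j)
  refine ⟨r, HasWeakDeriv.isPrimitive (P.left_lt_right j) hr hg ?_, he, ?_⟩
  · intro η hη hc hs
    rw [← h3 η hη hc hs]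
    refine setIntegral_congr_fun measurableSet_Ioo fun θ hθ => ?_
    simp only [he hθ]
  · filter_upwards [h1, ae_restrict_mem measurableSet_Ioo] with θ h4 h5
    rw [h4, he h5]

variable (W : Weight P) {ψ v g u q : ℝ → E}

/-- The integrand is the derivative of ⟨u, ρψ⟩, by the product rule applied twice. The end values
appear as one-sided limits because v is constrained only inside the segment. -/
theorem integral_segment (hu : IsPrimitive (-P.delay) 0 u q) (hψ : IsPiecewiseSobolev P ψ v g)
    (j : Fin (J + 1)) :
    IntegrableOn (fun θ => inner ℝ (q θ) (W.ρ θ • ψ θ) +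
      inner ℝ (u θ) (deriv W.ρ θ • ψ θ + W.ρ θ • g θ)) (Ioo (P.left j) (P.right j)) ∧
    ∫ θ in Ioo (P.left j) (P.right j), (inner ℝ (q θ) (W.ρ θ • ψ θ) +
      inner ℝ (u θ) (deriv W.ρ θ • ψ θ + W.ρ θ • g θ)) =
      inner ℝ (u (P.right j)) (Function.leftLim (fun θ => W.ρ θ • v θ) (P.right j)) -
      inner ℝ (u (P.left j)) (Function.rightLim (fun θ => W.ρ θ • v θ) (P.left j)) := by
  obtain ⟨r, hr, hvr, hψr⟩ := hψ.exists_rep j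
  have hlt := P.left_lt_right j
  have h1 := (W.isPrimitive_rep j).bilin (ContinuousLinearMap.lsmul ℝ ℝ) hr
  have h2 := (hu.mono (P.neg_delay_le_left j) (P.right_nonpos j)).bilin (innerSL ℝ) h1
  have hae : (fun θ => inner ℝ (q θ) (W.ρ θ • ψ θ) +
      inner ℝ (u θ) (deriv W.ρ θ • ψ θ + W.ρ θ • g θ))
      =ᵐ[volume.restrict (Ioo (P.left j) (P.right j))]
      fun t => innerSL ℝ (q t) (ContinuousLinearMap.lsmul ℝ ℝ (W.rep j t) (r t)) +
        innerSL ℝ (u t) (ContinuousLinearMap.lsmul ℝ ℝ (deriv W.ρ t) (r t) +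
          ContinuousLinearMap.lsmul ℝ ℝ (W.rep j t) (g t)) := by
    filter_upwards [hψr, ae_restrict_mem measurableSet_Ioo] with θ h3 h4
    simp only [h3, W.eqOn_rep j h4]
    rfl
  have hc : ContinuousOn (fun θ => W.rep j θ • r θ) (Icc (P.left j) (P.right j)) :=
    (W.continuousOn_rep j).smul hr.continuousOn
  have he : EqOn (fun θ => W.ρ θ • v θ) (fun θ => W.rep j θ • r θ) (Ioo (P.left j) (P.right j)) :=
    fun θ hθ => by simp only [W.eqOn_rep j hθ, hvr hθ]
  refine ⟨h2.1.congr hae.symm, ?_⟩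
  rw [integral_congr_ae hae, h2.integral_eq_sub hlt.le, leftLim_eq_of_eqOn hlt hc he,
    rightLim_eq_of_eqOn hlt hc he]
  rfl

theorem IsPiecewiseSobolev.leftLim_smul_zero (hψ : IsPiecewiseSobolev P ψ v g) :
    Function.leftLim (fun θ => W.ρ θ • v θ) 0 = Function.leftLim W.ρ 0 • Function.leftLim v 0 := by
  obtain ⟨r, hr, hvr, -⟩ := hψ.exists_rep 0
  have hlt := P.left_lt_right 0
  rw [← P.right_zero, W.leftLim_right, leftLim_eq_of_eqOn hlt hr.continuousOn hvr]
  exact leftLim_eq_of_eqOn hlt ((W.continuousOn_rep 0).smul hr.continuousOn)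
    fun θ hθ => by simp only [W.eqOn_rep 0 hθ, hvr hθ, Pi.smul_apply']

theorem IsPiecewiseSobolev.rightLim_smul_neg_delay (hψ : IsPiecewiseSobolev P ψ v g) :
    Function.rightLim (fun θ => W.ρ θ • v θ) (-P.delay) =
      Function.rightLim W.ρ (-P.delay) • Function.rightLim v (-P.delay) := by
  obtain ⟨r, hr, hvr, -⟩ := hψ.exists_rep (Fin.last J)
  have hlt := P.left_lt_right (Fin.last J)
  rw [← P.left_last, W.rightLim_left, rightLim_eq_of_eqOn hlt hr.continuousOn hvr]
  exact rightLim_eq_of_eqOn hlt ((W.continuousOn_rep _).smul hr.continuousOn)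
    fun θ hθ => by simp only [W.eqOn_rep _ hθ, hvr hθ, Pi.smul_apply']

/-- Sums `integral_segment` over the segments. As u is continuous across the interior nodes, the two
one-sided contributions at each node merge into a single jump of ρv. -/
theorem integral_green (hu : IsPrimitive (-P.delay) 0 u q) (hψ : IsPiecewiseSobolev P ψ v g) :
    ∫ θ in Ioo (-P.delay) 0, (inner ℝ (q θ) (W.ρ θ • ψ θ) +
      inner ℝ (u θ) (deriv W.ρ θ • ψ θ + W.ρ θ • g θ)) =
      inner ℝ (u 0) (Function.leftLim W.ρ 0 • Function.leftLim v 0) -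
      inner ℝ (u (-P.delay))
        (Function.rightLim W.ρ (-P.delay) • Function.rightLim v (-P.delay)) -
      ∑ j, inner ℝ (u (P.node j)) (jump (fun θ => W.ρ θ • v θ) (P.node j)) := by
  rw [P.integral_eq_sum (P.integrableOn_iff.2 fun j => (integral_segment W hu hψ j).1),
    Finset.sum_congr rfl fun j _ => (integral_segment W hu hψ j).2,
    sum_segments_eq (fun j => inner ℝ (u (P.right j))
      (Function.leftLim (fun θ => W.ρ θ • v θ) (P.right j))) fun j =>
      inner ℝ (u (P.left j)) (Function.rightLim (fun θ => W.ρ θ • v θ) (P.left j))]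
  simp only [P.right_zero, P.left_last, hψ.leftLim_smul_zero W, hψ.rightLim_smul_neg_delay W,
    P.left_castSucc, P.right_succ, jump, inner_sub_right]

end Green

/-! ### Elements of the delay space -/

theorem integrable_bilin_of_memLp {F G K : Type*} [NormedAddCommGroup F] [NormedSpace ℝ F]
    [NormedAddCommGroup G] [NormedSpace ℝ G] [NormedAddCommGroup K] [NormedSpace ℝ K]
    (B : F →L[ℝ] G →L[ℝ] K) {μ : Measure ℝ} {f : ℝ → F} {g : ℝ → G} (hf : MemLp f 2 μ)
    (hg : MemLp g 2 μ) : Integrable (fun t => B (f t) (g t)) μ := by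
  refine ((hf.norm.integrable_mul hg.norm).const_mul ‖B‖).mono'
    (B.aestronglyMeasurable_comp₂ hf.aestronglyMeasurable hg.aestronglyMeasurable)
    (Filter.Eventually.of_forall fun t => ?_)
  simp only [Pi.mul_apply]
  rw [← mul_assoc]
  exact B.le_opNorm₂ _ _

theorem integrable_inner_of_memLp {E : Type*} [NormedAddCommGroup E] [InnerProductSpace ℝ E]
    {μ : Measure ℝ} {f g : ℝ → E} (hf : MemLp f 2 μ) (hg : MemLp g 2 μ) :
    Integrable (fun t => inner ℝ (f t) (g t)) μ :=
  integrable_bilin_of_memLp (innerSL ℝ) hf hg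

theorem memLp_of_continuousOn {F : Type*} [NormedAddCommGroup F] {a b : ℝ} {u : ℝ → F}
    (hu : ContinuousOn u (Icc a b)) : MemLp u 2 (volume.restrict (Ioo a b)) := by
  obtain ⟨K, hK⟩ := isCompact_Icc.exists_bound_of_continuousOn hu
  refine MemLp.of_bound ((hu.mono Ioo_subset_Icc_self).aestronglyMeasurable measurableSet_Ioo) K ?_
  filter_upwards [ae_restrict_mem measurableSet_Ioo] with θ hθ
  exact hK θ (Ioo_subset_Icc_self hθ)

section Elements

variable {E : Type*} [NormedAddCommGroup E] [InnerProductSpace ℝ E] {J I : ℕ}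
  {P : DelayPartition J} (W : Weight P) (C : DelayCoeffs E P I)

theorem IsPiecewiseSobolev.memLp {ψ v g : ℝ → E} (h : IsPiecewiseSobolev P ψ v g) :
    MemLp g 2 (volume.restrict (Ioo (-P.delay) 0)) := h.1

/-- The element `(x, f)` of the delay space. -/
def mkElement (x : E) {f : ℝ → E} (hf : MemLp f 2 (volume.restrict (Ioo (-P.delay) 0))) :
    DelaySpace E W :=
  WithLp.toLp 2 (x, (W.memLp_measure_iff.2 hf).toLp f)

@[simp]
theorem mkElement_fst (x : E) {f : ℝ → E} (hf : MemLp f 2 (volume.restrict (Ioo (-P.delay) 0))) :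
    (mkElement W x hf).fst = x := rfl

theorem mkElement_snd (x : E) {f : ℝ → E} (hf : MemLp f 2 (volume.restrict (Ioo (-P.delay) 0))) :
    (mkElement W x hf).snd =ᵐ[volume.restrict (Ioo (-P.delay) 0)] f :=
  W.ae_measure_iff.1 (MemLp.coeFn_toLp (W.memLp_measure_iff.2 hf))

variable {W} in
theorem delaySpace_ext {p q : DelaySpace E W} (h1 : p.fst = q.fst)
    (h2 : p.snd =ᵐ[volume.restrict (Ioo (-P.delay) 0)] q.snd) : p = q :=
  (WithLp.equiv 2 _).injective (Prod.ext h1 (Lp.ext (W.ae_measure_iff.2 h2)))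

theorem inner_eq_of_ae (p q : DelaySpace E W) {φ ψ : ℝ → E}
    (hφ : p.snd =ᵐ[volume.restrict (Ioo (-P.delay) 0)] φ)
    (hψ : q.snd =ᵐ[volume.restrict (Ioo (-P.delay) 0)] ψ) :
    inner ℝ p q = inner ℝ p.fst q.fst +
      ∫ θ in Ioo (-P.delay) 0, W.ρ θ * inner ℝ (φ θ) (ψ θ) := by
  rw [inner_delaySpace]
  congr 1
  refine integral_congr_ae ?_
  filter_upwards [hφ, hψ] with θ h1 h2
  rw [h1, h2]

theorem memLp_rho_smul {f : ℝ → E} (hf : MemLp f 2 (volume.restrict (Ioo (-P.delay) 0))) :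
    MemLp (fun θ => W.ρ θ • f θ) 2 (volume.restrict (Ioo (-P.delay) 0)) :=
  memLp_smul_of_bound W.aemeasurable W.exists_bound hf

theorem memLp_inv_rho_smul {f : ℝ → E} (hf : MemLp f 2 (volume.restrict (Ioo (-P.delay) 0))) :
    MemLp (fun θ => (W.ρ θ)⁻¹ • f θ) 2 (volume.restrict (Ioo (-P.delay) 0)) :=
  memLp_smul_of_bound W.aemeasurable.inv W.exists_bound_inv hf

theorem memLp_logDeriv_smul {f : ℝ → E} (hf : MemLp f 2 (volume.restrict (Ioo (-P.delay) 0))) :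
    MemLp (fun θ => (deriv W.ρ θ / W.ρ θ) • f θ) 2 (volume.restrict (Ioo (-P.delay) 0)) := by
  have := memLp_smul_of_bound W.aemeasurable_deriv W.exists_bound_deriv (memLp_inv_rho_smul W hf)
  simpa only [div_eq_mul_inv, mul_smul] using this

theorem DelayCoeffs.integrable_apply {φ : ℝ → E}
    (hφ : MemLp φ 2 (volume.restrict (Ioo (-P.delay) 0))) (i : Fin I) :
    Integrable (fun θ => C.M i θ (φ θ)) (volume.restrict (Ioo (-P.delay) 0)) :=
  integrable_bilin_of_memLp (ContinuousLinearMap.id ℝ (E →L[ℝ] E)) (C.memLp i) hφ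

theorem DelayCoeffs.integralPart_congr {φ ψ : ℝ → E}
    (h : φ =ᵐ[volume.restrict (Ioo (-P.delay) 0)] ψ) : C.integralPart φ = C.integralPart ψ := by
  refine Finset.sum_congr rfl fun i _ => integral_congr_ae ?_
  filter_upwards [h] with θ hθ
  rw [hθ]

theorem memLp_of_contDiff {u : ℝ → E} {n : WithTop ℕ∞} (hu : ContDiff ℝ n u) (a b : ℝ) :
    MemLp u 2 (volume.restrict (Ioo a b)) :=
  memLp_of_continuousOn hu.continuous.continuousOn

theorem contDiff_deriv_of_contDiff {u : ℝ → E} (hu : ContDiff ℝ ∞ u) : ContDiff ℝ ∞ (deriv u) :=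
  (contDiff_infty_iff_deriv.1 hu).2

/-- Lagrange interpolation at the points -τ_i. It makes the values at 0, at -τ and at the interior
nodes independent of each other. -/
theorem exists_contDiff_eq (P : DelayPartition J) (x a : E) (b : Fin J → E) :
    ∃ u : ℝ → E, ContDiff ℝ ∞ u ∧ u 0 = x ∧ u (-P.delay) = a ∧ ∀ j, u (P.node j) = b j := by
  classical
  have hinj : InjOn (fun i => -P.τ i) (Finset.univ : Finset (Fin (J + 2))) :=
    fun i _ j _ h => P.strictMono.injective (neg_injective h)
  -- The order follows τ_0 = 0, then the interior delays, then τ_{J+1} = τ.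
  let c : Fin (J + 2) → E := Fin.cons x (Fin.snoc b a : Fin (J + 1) → E)
  let u : ℝ → E := fun θ =>
    ∑ i, (Lagrange.basis Finset.univ (fun i => -P.τ i) i).eval θ • c i
  have hu : ∀ i, u (-P.τ i) = c i := fun i => by
    simp only [u]
    rw [Finset.sum_eq_single i]
    · rw [Lagrange.eval_basis_self (v := fun i => -P.τ i) hinj (Finset.mem_univ i), one_smul]
    · intro k _ hk
      rw [Lagrange.eval_basis_of_ne (v := fun i => -P.τ i) hk (Finset.mem_univ i), zero_smul]
    · simp
  refine ⟨u, ?_, ?_, ?_, fun j => ?_⟩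
  · refine ContDiff.sum fun i _ => ContDiff.smul ?_ contDiff_const
    simpa using Polynomial.contDiff_aeval (Lagrange.basis Finset.univ (fun i => -P.τ i) i)
      (𝕜 := ℝ) (n := ∞)
  · have := hu 0
    rw [P.τ_zero, neg_zero] at this
    rw [this]
    rfl
  · rw [DelayPartition.delay, hu, ← Fin.succ_last]
    simp only [c, Fin.cons_succ, Fin.snoc_last]
  · rw [DelayPartition.node, hu, ← Fin.succ_castSucc]
    simp only [c, Fin.cons_succ, Fin.snoc_castSucc]

theorem contDiff_smul_vec {η : ℝ → ℝ} (hη : ContDiff ℝ ∞ η) (e : E) :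
    ContDiff ℝ ∞ (fun θ => η θ • e) := hη.smul contDiff_const

/-! ### Test functions supported in one segment -/

section TestFunctions

variable {η : ℝ → ℝ} {j : Fin (J + 1)}

theorem eq_zero_of_not_mem_segment (hs : tsupport η ⊆ Ioo (P.left j) (P.right j)) {θ : ℝ}
    (hθ : θ ∉ Ioo (P.left j) (P.right j)) : η θ = 0 :=
  image_eq_zero_of_notMem_tsupport fun h => hθ (hs h)

theorem testFunction_zero (hs : tsupport η ⊆ Ioo (P.left j) (P.right j)) : η 0 = 0 :=
  eq_zero_of_not_mem_segment hs fun h => absurd h.2 (not_lt.2 (P.right_nonpos j))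

theorem testFunction_neg_delay (hs : tsupport η ⊆ Ioo (P.left j) (P.right j)) : η (-P.delay) = 0 :=
  eq_zero_of_not_mem_segment hs fun h => absurd h.1 (not_lt.2 (P.neg_delay_le_left j))

theorem testFunction_node (hs : tsupport η ⊆ Ioo (P.left j) (P.right j))
    (i : Fin J) : η (P.node i) = 0 := by
  refine eq_zero_of_not_mem_segment hs fun h => ?_
  rcases lt_or_ge i.castSucc j with hij | hij
  · exact absurd h.2 (not_lt.2 (P.left_castSucc i ▸ P.right_le_left hij))
  · have h1 : j < i.succ := lt_of_le_of_lt hij Fin.castSucc_lt_succ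
    exact absurd h.1 (not_lt.2 (P.right_le_left h1))

theorem setIntegral_eq_segment {F : Type*} [NormedAddCommGroup F] [NormedSpace ℝ F]
    {f : ℝ → F} (hf : ∀ θ, θ ∉ Ioo (P.left j) (P.right j) → f θ = 0) :
    ∫ θ in Ioo (-P.delay) 0, f θ = ∫ θ in Ioo (P.left j) (P.right j), f θ := by
  rw [setIntegral_eq_integral_of_forall_compl_eq_zero hf,
    setIntegral_eq_integral_of_forall_compl_eq_zero fun θ hθ =>
      hf θ fun h => hθ (P.segment_subset j h)]

end TestFunctions

/-! ### The adjoint of the integral term and Green's formula for the delay operator -/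

variable [CompleteSpace E]

/-- The function `∑_i M_i* y`. -/
def DelayCoeffs.kernel (y : E) (θ : ℝ) : E := ∑ i, (C.M i θ).adjoint y

theorem DelayCoeffs.memLp_adjoint (y : E) (i : Fin I) :
    MemLp (fun θ => (C.M i θ).adjoint y) 2 (volume.restrict (Ioo (-P.delay) 0)) := by
  refine MemLp.of_le_mul (c := ‖y‖) (C.memLp i) ?_ (Filter.Eventually.of_forall fun θ => ?_)
  · have hc : Continuous fun T : E →L[ℝ] E => T.adjoint y :=
      (ContinuousLinearMap.apply ℝ E y).continuous.comp ContinuousLinearMap.adjoint.continuous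
    exact hc.comp_aestronglyMeasurable (C.memLp i).aestronglyMeasurable
  · refine ((C.M i θ).adjoint.le_opNorm y).trans ?_
    rw [LinearIsometryEquiv.norm_map, mul_comm]

theorem DelayCoeffs.memLp_kernel (y : E) :
    MemLp (C.kernel y) 2 (volume.restrict (Ioo (-P.delay) 0)) :=
  memLp_finsetSum _ fun i _ => C.memLp_adjoint y i

theorem DelayCoeffs.inner_integralPart {φ : ℝ → E}
    (hφ : MemLp φ 2 (volume.restrict (Ioo (-P.delay) 0))) (y : E) :
    inner ℝ (C.integralPart φ) y = ∫ θ in Ioo (-P.delay) 0, inner ℝ (φ θ) (C.kernel y θ) := by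
  simp only [integralPart, kernel, inner_sum, sum_inner]
  rw [integral_finsetSum]
  · refine Finset.sum_congr rfl fun i _ => ?_
    rw [real_inner_comm, ← integral_inner (C.integrable_apply hφ i)]
    refine integral_congr_ae (Filter.Eventually.of_forall fun θ => ?_)
    simp only [ContinuousLinearMap.adjoint_inner_right]
    exact real_inner_comm _ _
  · exact fun i _ => integrable_inner_of_memLp hφ (C.memLp_adjoint y i)

/-- The second component of the adjoint. -/
def adjointSnd (y : E) (ψ g : ℝ → E) (θ : ℝ) : E :=
  -g θ - (deriv W.ρ θ / W.ρ θ) • ψ θ + (W.ρ θ)⁻¹ • C.kernel y θ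

theorem memLp_adjointSnd (y : E) {ψ g : ℝ → E}
    (hψ : MemLp ψ 2 (volume.restrict (Ioo (-P.delay) 0)))
    (hg : MemLp g 2 (volume.restrict (Ioo (-P.delay) 0))) :
    MemLp (adjointSnd W C y ψ g) 2 (volume.restrict (Ioo (-P.delay) 0)) :=
  (hg.neg.sub (memLp_logDeriv_smul W hψ)).add (memLp_inv_rho_smul W (C.memLp_kernel y))

variable {W C} in
theorem DelayRel.exists_isPrimitive {p q : DelaySpace E W} (h : DelayRel W C p q) :
    ∃ u : ℝ → E, IsPrimitive (-P.delay) 0 u q.snd ∧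
      p.snd =ᵐ[volume.restrict (Ioo (-P.delay) 0)] u ∧ u 0 = p.fst ∧ q.fst = C.functional u := by
  obtain ⟨u, hu, hpu, hd, h0, hq⟩ := h
  exact ⟨u, hd.isPrimitive P.neg_delay_lt_zero hu
    ((W.memLp_volume q.snd).integrable one_le_two), hpu, h0, hq⟩

/-- The adjoint vector `(L_0* y + ρ(0) ψ(0), -ψ' - (ρ'/ρ) ψ + (1/ρ) ∑_i M_i* y)`. -/
def adjointVector (s : DelaySpace E W) (v : ℝ → E) {g : ℝ → E}
    (hg : MemLp g 2 (volume.restrict (Ioo (-P.delay) 0))) : DelaySpace E W :=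
  mkElement W (C.L₀.adjoint s.fst + Function.leftLim W.ρ 0 • Function.leftLim v 0)
    (memLp_adjointSnd W C s.fst (W.memLp_volume s.snd) hg)

/-- Green's formula for the delay operator. -/
theorem inner_green {p q s : DelaySpace E W} {u v g : ℝ → E}
    (hu : IsPrimitive (-P.delay) 0 u q.snd)
    (hpu : p.snd =ᵐ[volume.restrict (Ioo (-P.delay) 0)] u) (h0 : u 0 = p.fst)
    (hq : q.fst = C.functional u) (hs : IsPiecewiseSobolev P s.snd v g) :
    inner ℝ q s = inner ℝ p (adjointVector W C s v hs.memLp) +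
      (inner ℝ (u (-P.delay)) (C.Lτ.adjoint s.fst -
        Function.rightLim W.ρ (-P.delay) • Function.rightLim v (-P.delay)) +
      ∑ j, inner ℝ (u (P.node j)) ((C.Lj j).adjoint s.fst -
        jump (fun θ => W.ρ θ • v θ) (P.node j))) := by
  have hψ := W.memLp_volume s.snd
  have hul : MemLp u 2 (volume.restrict (Ioo (-P.delay) 0)) := memLp_of_continuousOn hu.continuousOn
  have hk := C.memLp_kernel s.fst
  have hderiv : MemLp (fun θ => deriv W.ρ θ • s.snd θ) 2 (volume.restrict (Ioo (-P.delay) 0)) :=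
    memLp_smul_of_bound W.aemeasurable_deriv W.exists_bound_deriv hψ
  have hsum : MemLp (fun θ => deriv W.ρ θ • s.snd θ + W.ρ θ • g θ) 2
      (volume.restrict (Ioo (-P.delay) 0)) := hderiv.add (memLp_rho_smul W hs.memLp)
  have green := integral_green W hu hs
  rw [integral_add (integrable_inner_of_memLp (W.memLp_volume q.snd) (memLp_rho_smul W hψ))
    (integrable_inner_of_memLp hul hsum)] at green
  have e1 : ∫ θ in Ioo (-P.delay) 0, W.ρ θ * inner ℝ (q.snd θ) (s.snd θ) =
      ∫ θ in Ioo (-P.delay) 0, inner ℝ (q.snd θ) (W.ρ θ • s.snd θ) := by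
    simp only [inner_smul_right]
  -- The second adjoint component is designed so that ρ times it equals ∑ M_i* y - (ρψ)'. The kernel
  -- part transposes the integral term of the functional, and the rest is the derivative term in
  -- Green's formula.
  have e2 : ∫ θ in Ioo (-P.delay) 0,
        W.ρ θ * inner ℝ (u θ) (adjointSnd W C s.fst s.snd g θ) =
      inner ℝ (C.integralPart u) s.fst -
        ∫ θ in Ioo (-P.delay) 0, inner ℝ (u θ) (deriv W.ρ θ • s.snd θ + W.ρ θ • g θ) := by
    rw [C.inner_integralPart hul, ← integral_sub (integrable_inner_of_memLp hul hk)
      (integrable_inner_of_memLp hul hsum)]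
    refine setIntegral_congr_fun measurableSet_Ioo fun θ hθ => ?_
    have hρ : W.ρ θ ≠ 0 := (W.pos_of_mem (Ioo_subset_Icc_self hθ)).ne'
    simp only [adjointSnd, inner_add_right, inner_sub_right, inner_neg_right, inner_smul_right]
    field_simp
    ring
  rw [adjointVector, inner_delaySpace, e1, inner_eq_of_ae W p _ hpu (mkElement_snd W _ _), e2,
    mkElement_fst, hq, ← h0]
  simp only [DelayCoeffs.functional, inner_add_left, inner_add_right, inner_sub_right, sum_inner,
    Finset.sum_sub_distrib, ContinuousLinearMap.adjoint_inner_right] at green ⊢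
  linarith

/-! ### Smooth elements -/

/-- The element `(u(0), u)`. -/
def smoothElement {u : ℝ → E} (hu : ContDiff ℝ ∞ u) : DelaySpace E W :=
  mkElement W (u 0) (memLp_of_contDiff hu _ _)

/-- The value of the delay operator at `(u(0), u)`. -/
def smoothImage {u : ℝ → E} (hu : ContDiff ℝ ∞ u) : DelaySpace E W :=
  mkElement W (C.functional u) (memLp_of_contDiff (contDiff_deriv_of_contDiff hu) _ _)

theorem isPrimitive_smoothImage {u : ℝ → E} (hu : ContDiff ℝ ∞ u) :
    IsPrimitive (-P.delay) 0 u (smoothImage W C hu).snd :=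
  (IsPrimitive.of_contDiff (hu.of_le (by simp))).congr P.neg_delay_lt_zero.le (fun _ _ => rfl)
    (mkElement_snd W _ _)

theorem delayRel_smooth {u : ℝ → E} (hu : ContDiff ℝ ∞ u) :
    DelayRel W C (smoothElement W hu) (smoothImage W C hu) :=
  ⟨u, hu.continuous.continuousOn, mkElement_snd W _ _,
    (isPrimitive_smoothImage W C hu).hasWeakDeriv P.neg_delay_lt_zero.le, rfl, rfl⟩

end Elements

/-! ### The adjoint of the delay operator -/

section Adjoint

variable {E : Type*} [NormedAddCommGroup E] [InnerProductSpace ℝ E] {J I : ℕ}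
  {P : DelayPartition J} (W : Weight P) (C : DelayCoeffs E P I)

theorem integrableOn_rho_smul (s : DelaySpace E W) :
    IntegrableOn (fun θ => W.ρ θ • s.snd θ) (Ioo (-P.delay) 0) :=
  (memLp_rho_smul W (W.memLp_volume s.snd)).integrable one_le_two

variable {η : ℝ → ℝ} {j : Fin (J + 1)}

theorem functional_testFunction (hs : tsupport η ⊆ Ioo (P.left j) (P.right j)) (e : E) :
    C.functional (fun θ => η θ • e) = C.integralPart (fun θ => η θ • e) := by
  simp [DelayCoeffs.functional, testFunction_zero hs, testFunction_neg_delay hs,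
    testFunction_node hs]

variable [CompleteSpace E]

theorem setIntegral_inner_smul_vec (hη : Continuous η) (hs : tsupport η ⊆ Ioo (P.left j) (P.right j))
    (e : E) {f : ℝ → E} (hf : IntegrableOn f (Ioo (-P.delay) 0)) :
    ∫ θ in Ioo (-P.delay) 0, inner ℝ (η θ • e) (f θ) =
      inner ℝ e (∫ θ in Ioo (P.left j) (P.right j), η θ • f θ) := by
  rw [setIntegral_eq_segment (j := j), ← integral_inner]
  · simp only [inner_smul_left, inner_smul_right]
    rfl
  · exact integrableOn_continuous_smul hη (hf.mono_set (P.segment_subset j))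
  · intro θ hθ
    rw [eq_zero_of_not_mem_segment hs hθ, zero_smul, inner_zero_left]

theorem inner_testElement (hη : ContDiff ℝ ∞ η) (hs : tsupport η ⊆ Ioo (P.left j) (P.right j))
    (e : E) (s : DelaySpace E W) :
    inner ℝ (smoothElement W (contDiff_smul_vec hη e)) s =
      inner ℝ e (∫ θ in Ioo (P.left j) (P.right j), η θ • (W.ρ θ • s.snd θ)) := by
  rw [smoothElement, inner_eq_of_ae W _ s (mkElement_snd W _ _) (ae_eq_refl _), mkElement_fst,
    testFunction_zero hs, zero_smul, inner_zero_left, zero_add,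
    ← setIntegral_inner_smul_vec hη.continuous hs e (integrableOn_rho_smul W s)]
  simp only [inner_smul_right]

theorem inner_testImage (hη : ContDiff ℝ ∞ η) (hs : tsupport η ⊆ Ioo (P.left j) (P.right j))
    (e : E) (s : DelaySpace E W) :
    inner ℝ (smoothImage W C (contDiff_smul_vec hη e)) s =
      inner ℝ e (∫ θ in Ioo (P.left j) (P.right j), η θ • C.kernel s.fst θ) +
      inner ℝ e (∫ θ in Ioo (P.left j) (P.right j), deriv η θ • (W.ρ θ • s.snd θ)) := by
  have hd : deriv (fun θ => η θ • e) = fun θ => deriv η θ • e := by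
    funext θ
    exact deriv_smul_const ((hη.differentiable (by simp)) θ) e
  have hs' : tsupport (deriv η) ⊆ Ioo (P.left j) (P.right j) := tsupport_deriv_subset.trans hs
  rw [smoothImage, inner_eq_of_ae W _ s (mkElement_snd W _ _) (ae_eq_refl _), mkElement_fst,
    functional_testFunction C hs, C.inner_integralPart
      (memLp_of_contDiff (contDiff_smul_vec hη e) _ _),
    setIntegral_inner_smul_vec hη.continuous hs e
      ((C.memLp_kernel s.fst).integrable one_le_two), hd,
    ← setIntegral_inner_smul_vec (hη.continuous_deriv (by simp)) hs' e (integrableOn_rho_smul W s)]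
  simp only [inner_smul_right]

variable {W} in
-- A test element vanishes at 0, so it sees only the function component. The fundamental lemma of
-- the calculus of variations gives ρψ = 0 on each segment, and ρ is positive.
theorem snd_ae_eq_zero_of_inner_testElement {s : DelaySpace E W}
    (h : ∀ (j : Fin (J + 1)) (η : ℝ → ℝ) (hη : ContDiff ℝ ∞ η),
      tsupport η ⊆ Ioo (P.left j) (P.right j) → ∀ e : E,
        inner ℝ (smoothElement W (contDiff_smul_vec hη e)) s = 0) :
    s.snd =ᵐ[volume.restrict (Ioo (-P.delay) 0)] 0 := by
  refine P.ae_restrict_iff.2 fun j => ?_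
  have key : (fun θ => W.ρ θ • s.snd θ) =ᵐ[volume.restrict (Ioo (P.left j) (P.right j))] 0 := by
    refine ae_eq_zero_of_forall_testFunction
      ((integrableOn_rho_smul W s).mono_set (P.segment_subset j)) fun η hη _ hs => ?_
    refine ext_inner_left ℝ fun e => ?_
    rw [← inner_testElement W hη hs e s, h j η hη hs e, inner_zero_right]
  filter_upwards [key, ae_restrict_mem measurableSet_Ioo] with θ h1 h2
  exact (smul_eq_zero.1 h1).resolve_left
    (W.pos_of_mem (Ioo_subset_Icc_self (P.segment_subset j h2))).ne'

variable {W} in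
-- A vector orthogonal to D has zero function component by the first hypothesis; pairing it with an
-- element of D whose value at 0 is its own first component then kills that component. The criterion
-- serves both D(L) and D(L) ∩ D(L*).
theorem dense_of_smoothElement_mem (D : Submodule ℝ (DelaySpace E W))
    (h1 : ∀ (j : Fin (J + 1)) (η : ℝ → ℝ) (hη : ContDiff ℝ ∞ η),
      tsupport η ⊆ Ioo (P.left j) (P.right j) → ∀ e : E,
        smoothElement W (contDiff_smul_vec hη e) ∈ D)
    (h2 : ∀ x : E, ∃ (u : ℝ → E) (hu : ContDiff ℝ ∞ u), u 0 = x ∧ smoothElement W hu ∈ D) :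
    Dense (D : Set (DelaySpace E W)) := by
  rw [Submodule.dense_iff_topologicalClosure_eq_top, Submodule.topologicalClosure_eq_top_iff,
    Submodule.eq_bot_iff]
  intro s hs
  rw [Submodule.mem_orthogonal] at hs
  have hsnd := snd_ae_eq_zero_of_inner_testElement fun j η hη hη' e => hs _ (h1 j η hη hη' e)
  refine delaySpace_ext ?_ (hsnd.trans (W.ae_eq_volume (Lp.coeFn_zero E 2 W.measure)).symm)
  obtain ⟨u, hu, hu0, hD⟩ := h2 s.fst
  have h3 := hs _ hD
  rw [inner_eq_of_ae W _ s (ae_eq_refl _) hsnd] at h3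
  simp only [Pi.zero_apply, inner_zero_right, mul_zero, integral_zero, add_zero, smoothElement,
    mkElement_fst, hu0, inner_self_eq_zero] at h3
  exact h3

/-- The identity `⟨L p, s⟩ = ⟨p, t⟩` for all `p ∈ D(L)`. -/
def IsAdjointPair (s t : DelaySpace E W) : Prop :=
  ∀ p q, DelayRel W C p q → inner ℝ q s = inner ℝ p t

theorem mem_domain_iff (p : DelaySpace E W) :
    p ∈ (delayOperator W C).domain ↔ ∃ q, DelayRel W C p q := by
  rw [LinearPMap.mem_domain_iff]
  simp only [mem_graph_delayOperator]

theorem delayRel_apply (p : (delayOperator W C).domain) :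
    DelayRel W C p (delayOperator W C p) :=
  (mem_graph_delayOperator W C _ _).1 (LinearPMap.mem_graph _ p)

variable {W C} in
theorem DelayRel.apply_eq {p q : DelaySpace E W} (h : DelayRel W C p q)
    (hp : p ∈ (delayOperator W C).domain) : delayOperator W C ⟨p, hp⟩ = q := by
  have h1 := (mem_graph_delayOperator W C p q).2 h
  exact LinearPMap.mem_graph_snd_inj _ (LinearPMap.mem_graph _ ⟨p, hp⟩) h1 rfl

theorem smoothElement_mem_domain {u : ℝ → E} (hu : ContDiff ℝ ∞ u) :
    smoothElement W hu ∈ (delayOperator W C).domain :=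
  (mem_domain_iff W C _).2 ⟨_, delayRel_smooth W C hu⟩

theorem dense_domain : Dense ((delayOperator W C).domain : Set (DelaySpace E W)) :=
  dense_of_smoothElement_mem _ (fun _ _ hη _ e =>
    smoothElement_mem_domain W C (contDiff_smul_vec hη e)) fun x =>
    ⟨fun _ => x, contDiff_const, rfl, smoothElement_mem_domain W C contDiff_const⟩

theorem isAdjointPair_adjoint (s : (delayOperator W C).adjoint.domain) :
    IsAdjointPair W C s ((delayOperator W C).adjoint s) := by
  intro p q hpq
  have hp : p ∈ (delayOperator W C).domain := (mem_domain_iff W C p).2 ⟨q, hpq⟩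
  have h := (LinearPMap.adjoint_isFormalAdjoint (dense_domain W C)) s ⟨p, hp⟩
  rw [hpq.apply_eq hp] at h
  rw [real_inner_comm, ← h, real_inner_comm]

variable {W C} in
theorem IsAdjointPair.mem_domain {s t : DelaySpace E W} (h : IsAdjointPair W C s t) :
    s ∈ (delayOperator W C).adjoint.domain :=
  LinearPMap.mem_adjoint_domain_of_exists _ ⟨t, fun p => by
    rw [real_inner_comm, ← h p _ (delayRel_apply W C p), real_inner_comm]⟩

variable {W C} in
-- Test elements supported in one segment vanish at 0, at -τ and at every node, so no point values
-- survive in the adjoint identity and what is left is the weak equation (ρψ)' = ∑ M_i* y - ρχ, with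
-- χ the second component of t.
theorem IsAdjointPair.hasWeakDeriv {s t : DelaySpace E W} (h : IsAdjointPair W C s t)
    (j : Fin (J + 1)) : HasWeakDeriv (P.left j) (P.right j) (fun θ => W.ρ θ • s.snd θ)
      (fun θ => C.kernel s.fst θ - W.ρ θ • t.snd θ) := by
  intro η hη _ hs
  refine ext_inner_left ℝ fun e => ?_
  have h1 := h _ _ (delayRel_smooth W C (contDiff_smul_vec hη e))
  rw [inner_testImage W C hη hs, inner_testElement W hη hs] at h1
  simp only [smul_sub]
  rw [integral_sub, inner_neg_right, inner_sub_right]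
  · linarith
  · exact integrableOn_continuous_smul hη.continuous (IntegrableOn.mono_set
      ((C.memLp_kernel s.fst).integrable one_le_two) (P.segment_subset j))
  · exact integrableOn_continuous_smul hη.continuous
      ((integrableOn_rho_smul W t).mono_set (P.segment_subset j))

variable {W C} in
-- On each segment ρψ is almost everywhere a primitive, and ψ is recovered by multiplying with 1/ρ,
-- also a primitive.
theorem IsAdjointPair.exists_isPiecewiseSobolev {s t : DelaySpace E W} (h : IsAdjointPair W C s t) :
    ∃ v g, IsPiecewiseSobolev P s.snd v g := by
  have hh : MemLp (fun θ => C.kernel s.fst θ - W.ρ θ • t.snd θ) 2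
      (volume.restrict (Ioo (-P.delay) 0)) :=
    (C.memLp_kernel s.fst).sub (memLp_rho_smul W (W.memLp_volume t.snd))
  choose w hw hsw using fun j => (h.hasWeakDeriv j).exists_isPrimitive (P.left_lt_right j)
    ((integrableOn_rho_smul W s).mono_set (P.segment_subset j))
    (IntegrableOn.mono_set (hh.integrable one_le_two) (P.segment_subset j))
  -- Glues the local representatives. The open segments are disjoint, so at most one summand is
  -- nonzero; v is 0 at the nodes, where its value is irrelevant.
  let v : ℝ → E := fun θ => ∑ j, (Ioo (P.left j) (P.right j)).indicator
    (fun θ => (W.rep j θ)⁻¹ • w j θ) θ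
  have hv : ∀ j, EqOn v (fun θ => (W.rep j θ)⁻¹ • w j θ) (Ioo (P.left j) (P.right j)) := by
    intro j θ hθ
    simp only [v]
    rw [Finset.sum_eq_single j, indicator_of_mem hθ]
    · intro i _ hij
      refine indicator_of_notMem (fun hi => ?_) _
      rcases lt_or_gt_of_ne hij with hlt | hlt
      · linarith [P.right_le_left hlt, hθ.2, hi.1]
      · linarith [P.right_le_left hlt, hi.2, hθ.1]
    · simp
  -- The derivative is read off from ψ = (1/ρ)(ρψ): it is (1/ρ)(ρψ)' - (ρ'/ρ)ψ.
  refine ⟨v, fun θ => (W.ρ θ)⁻¹ • (C.kernel s.fst θ - W.ρ θ • t.snd θ) -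
    (deriv W.ρ θ / W.ρ θ) • s.snd θ, (memLp_inv_rho_smul W hh).sub
      (memLp_logDeriv_smul W (W.memLp_volume s.snd)), fun j => ?_⟩
  have hprim := (W.isPrimitive_inv_rep j).bilin (ContinuousLinearMap.lsmul ℝ ℝ) (hw j)
  refine ⟨?_, ⟨_, hprim.continuousOn, hv j⟩, ?_⟩
  · filter_upwards [hsw j, ae_restrict_mem measurableSet_Ioo] with θ h1 h2
    have hne := (W.pos_of_mem (Ioo_subset_Icc_self (P.segment_subset j h2))).ne'
    rw [hv j h2]
    simp only
    rw [← h1, ← W.eqOn_rep j h2, inv_smul_smul₀ hne]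
  · have hprim' := hprim.congr (P.left_lt_right j).le (fun _ _ => rfl)
      (g' := fun θ => (W.ρ θ)⁻¹ • (C.kernel s.fst θ - W.ρ θ • t.snd θ) -
        (deriv W.ρ θ / W.ρ θ) • s.snd θ) (by
        filter_upwards [hsw j, ae_restrict_mem measurableSet_Ioo] with θ h1 h2
        have hne := (W.pos_of_mem (Ioo_subset_Icc_self (P.segment_subset j h2))).ne'
        simp only [ContinuousLinearMap.lsmul_apply]
        rw [← h1, ← W.eqOn_rep j h2, smul_smul, add_comm, sub_eq_add_neg, ← neg_smul]
        congr 2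
        field_simp)
    intro η hη hc hs
    rw [← hprim'.hasWeakDeriv (P.left_lt_right j).le η hη hc hs]
    refine setIntegral_congr_fun measurableSet_Ioo fun θ hθ => ?_
    simp only [hv j hθ, ContinuousLinearMap.lsmul_apply]

variable {W C} in
theorem isAdjointPair_adjointVector {s : DelaySpace E W} {v g : ℝ → E}
    (hs : IsPiecewiseSobolev P s.snd v g) (hb : AdjointBoundary W C s.fst v) :
    IsAdjointPair W C s (adjointVector W C s v hs.memLp) := by
  intro p q hpq
  obtain ⟨u, hu, hpu, h0, hq⟩ := hpq.exists_isPrimitive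
  rw [inner_green W C hu hpu h0 hq hs, hb.1]
  simp [hb.2]

variable {W C} in
-- By Green's formula the difference d between t and the adjoint vector pairs with smooth elements
-- through the boundary residuals α and β alone. Test functions do not see these, so d has no
-- function component; freely prescribed point values then separate its first component from the
-- residuals.
theorem IsAdjointPair.eq_adjointVector {s t : DelaySpace E W} (h : IsAdjointPair W C s t)
    {v g : ℝ → E} (hs : IsPiecewiseSobolev P s.snd v g) :
    AdjointBoundary W C s.fst v ∧ t = adjointVector W C s v hs.memLp := by
  set α := C.Lτ.adjoint s.fst -
    Function.rightLim W.ρ (-P.delay) • Function.rightLim v (-P.delay) with hα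
  set β : Fin J → E := fun j => (C.Lj j).adjoint s.fst -
    jump (fun θ => W.ρ θ • v θ) (P.node j) with hβ
  set d := t - adjointVector W C s v hs.memLp with hd
  have key : ∀ (u : ℝ → E) (hu : ContDiff ℝ ∞ u), inner ℝ (smoothElement W hu) d =
      inner ℝ (u (-P.delay)) α + ∑ j, inner ℝ (u (P.node j)) (β j) := by
    intro u hu
    have h1 := h _ _ (delayRel_smooth W C hu)
    rw [inner_green W C (p := smoothElement W hu) (isPrimitive_smoothImage W C hu)
      (mkElement_snd W _ _) rfl rfl hs] at h1
    rw [hd, inner_sub_right, ← h1]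
    ring
  have hsnd : d.snd =ᵐ[volume.restrict (Ioo (-P.delay) 0)] 0 := by
    refine snd_ae_eq_zero_of_inner_testElement fun j η hη hη' e => ?_
    rw [key]
    simp [testFunction_neg_delay hη', testFunction_node hη']
  have key2 : ∀ (x a : E) (b : Fin J → E),
      inner ℝ x d.fst = inner ℝ a α + ∑ j, inner ℝ (b j) (β j) := by
    intro x a b
    obtain ⟨u, hu, hx, ha, hb⟩ := exists_contDiff_eq P x a b
    have h1 := key u hu
    rw [inner_eq_of_ae W _ d (ae_eq_refl _) hsnd] at h1
    simpa [smoothElement, hx, ha, hb] using h1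
  have hfst : d.fst = 0 := by
    have := key2 d.fst 0 0
    simpa using this
  -- Choosing the residuals themselves as point values gives |α|² + ∑ |β_j|² = 0.
  have hsum := key2 0 α β
  rw [inner_zero_left] at hsum
  have hα0 : 0 ≤ inner ℝ α α := real_inner_self_nonneg
  have hβ0 : ∀ j ∈ Finset.univ, 0 ≤ inner ℝ (β j) (β j) := fun j _ => real_inner_self_nonneg
  have hβs := Finset.sum_nonneg hβ0
  have hα1 : α = 0 := (inner_self_eq_zero (𝕜 := ℝ)).1 (by linarith)
  have hβ1 := (Finset.sum_eq_zero_iff_of_nonneg hβ0).1 (by linarith)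
  refine ⟨⟨sub_eq_zero.1 hα1, fun j => sub_eq_zero.1
    ((inner_self_eq_zero (𝕜 := ℝ)).1 (hβ1 j (Finset.mem_univ j)))⟩, ?_⟩
  rw [← sub_eq_zero]
  exact delaySpace_ext hfst (hsnd.trans (W.ae_eq_volume (Lp.coeFn_zero E 2 W.measure)).symm)

theorem mem_adjoint_domain_iff (s : DelaySpace E W) : s ∈ (delayOperator W C).adjoint.domain ↔
    ∃ v g, IsPiecewiseSobolev P s.snd v g ∧ AdjointBoundary W C s.fst v := by
  constructor
  · intro hs
    have h := isAdjointPair_adjoint W C ⟨s, hs⟩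
    obtain ⟨v, g, hvg⟩ := h.exists_isPiecewiseSobolev
    exact ⟨v, g, hvg, (h.eq_adjointVector hvg).1⟩
  · rintro ⟨v, g, hvg, hb⟩
    exact (isAdjointPair_adjointVector hvg hb).mem_domain

theorem adjoint_apply (s : (delayOperator W C).adjoint.domain) {v g : ℝ → E}
    (hs : IsPiecewiseSobolev P (s : DelaySpace E W).snd v g) :
    (delayOperator W C).adjoint s = adjointVector W C s v hs.memLp :=
  ((isAdjointPair_adjoint W C s).eq_adjointVector hs).2

end Adjoint

/-! ### Self-adjoint extensions of bounded symmetric operators -/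

section Extension

variable {H : Type*} [NormedAddCommGroup H] [InnerProductSpace ℝ H] [CompleteSpace H]

theorem isSelfAdjoint_toPMap_top {B : H →L[ℝ] H} (hB : IsSelfAdjoint B) :
    IsSelfAdjoint ((B : H →ₗ[ℝ] H).toPMap ⊤) := by
  rw [LinearPMap.isSelfAdjoint_def,
    ContinuousLinearMap.toPMap_adjoint_eq_adjoint_toPMap_of_dense B (by simp),
    ContinuousLinearMap.isSelfAdjoint_iff'.1 hB]

/-- For y in D(S) and x in D, symmetry gives ⟨Sy, x⟩ = ⟨y, Bx⟩ = ⟨By, x⟩, so S = B on D(S) by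
density. Then By witnesses that any y lies in D(S*), which is D(S). -/
theorem eq_toPMap_top_of_eqOn_dense {B : H →L[ℝ] H} (hB : IsSelfAdjoint B) {S : H →ₗ.[ℝ] H}
    (hS : IsSelfAdjoint S) {D : Submodule ℝ H} (hD : Dense (D : Set H)) (hDS : D ≤ S.domain)
    (h : ∀ x (hx : x ∈ D), S ⟨x, hDS hx⟩ = B x) : S = (B : H →ₗ[ℝ] H).toPMap ⊤ := by
  have hS' : S.adjoint = S := LinearPMap.isSelfAdjoint_def.1 hS
  have hfa : S.IsFormalAdjoint S := by
    have := LinearPMap.adjoint_isFormalAdjoint hS.dense_domain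
    rwa [hS'] at this
  have hBs : ∀ x y, inner ℝ (B x) y = inner ℝ x (B y) := fun x y => by
    rw [← ContinuousLinearMap.adjoint_inner_right, ContinuousLinearMap.isSelfAdjoint_iff'.1 hB]
  have hval : ∀ y : S.domain, S y = B y := fun y => by
    refine hD.eq_of_inner_left ℝ fun x hx => ?_
    rw [hfa y ⟨x, hDS hx⟩, h x hx, hBs]
  have hdom : S.domain = ⊤ := by
    rw [Submodule.eq_top_iff']
    intro y
    rw [← hS']
    exact LinearPMap.mem_adjoint_domain_of_exists y ⟨B y, fun x => by rw [hval x, hBs]⟩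
  refine LinearPMap.ext (by rw [hdom]; rfl) fun y hy _ => ?_
  rw [hval ⟨y, hy⟩]
  rfl

end Extension

/-! ### The additive symmetrization of the delay operator -/

section Symmetrization

variable {E : Type*} [NormedAddCommGroup E] [InnerProductSpace ℝ E] [CompleteSpace E] {J I : ℕ}
  {P : DelayPartition J} (W : Weight P) (C : DelayCoeffs E P I)

variable {W} in
theorem isPiecewiseSobolev_of_isPrimitive {p q : DelaySpace E W} {u : ℝ → E}
    (hu : IsPrimitive (-P.delay) 0 u q.snd)
    (hpu : p.snd =ᵐ[volume.restrict (Ioo (-P.delay) 0)] u) :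
    IsPiecewiseSobolev P p.snd u q.snd := by
  refine ⟨W.memLp_volume q.snd, fun j => ⟨P.ae_restrict_iff.1 hpu j, ⟨u, ?_, fun _ _ => rfl⟩, ?_⟩⟩
  · exact hu.continuousOn.mono (Icc_subset_Icc (P.neg_delay_le_left j) (P.right_nonpos j))
  · exact (hu.mono (P.neg_delay_le_left j) (P.right_nonpos j)).hasWeakDeriv (P.left_lt_right j).le

/-! ### One-sided limits and jumps in the presence of a continuous function -/

section Continuous

variable {F : Type*} [NormedAddCommGroup F] {u : ℝ → F}

theorem leftLim_zero_of_continuousOn (hu : ContinuousOn u (Icc (-P.delay) 0)) :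
    Function.leftLim u 0 = u 0 :=
  leftLim_eq_of_eqOn P.neg_delay_lt_zero hu fun _ _ => rfl

theorem rightLim_neg_delay_of_continuousOn (hu : ContinuousOn u (Icc (-P.delay) 0)) :
    Function.rightLim u (-P.delay) = u (-P.delay) :=
  rightLim_eq_of_eqOn P.neg_delay_lt_zero hu fun _ _ => rfl

/-- Continuity of u at the node lets it be pulled out of the jump. This converts the adjoint
conditions on D(L) into conditions on point values. -/
theorem jump_smul_of_continuousOn [NormedSpace ℝ F] (hu : ContinuousOn u (Icc (-P.delay) 0))
    (j : Fin J) :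
    jump (fun θ => W.ρ θ • u θ) (P.node j) = jump W.ρ (P.node j) • u (P.node j) := by
  have hc : ∀ i, ContinuousOn (fun θ => W.rep i θ • u θ) (Icc (P.left i) (P.right i)) := fun i =>
    (W.continuousOn_rep i).smul
      (hu.mono (Icc_subset_Icc (P.neg_delay_le_left i) (P.right_nonpos i)))
  have he : ∀ i, EqOn (fun θ => W.ρ θ • u θ) (fun θ => W.rep i θ • u θ)
      (Ioo (P.left i) (P.right i)) := fun i θ hθ => by simp only [W.eqOn_rep i hθ]
  have h1 := rightLim_eq_of_eqOn (P.left_lt_right j.castSucc) (hc _) (he _)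
  have h2 := leftLim_eq_of_eqOn (P.left_lt_right j.succ) (hc _) (he _)
  have h3 := W.rightLim_left j.castSucc
  have h4 := W.leftLim_right j.succ
  rw [P.left_castSucc] at h1 h3
  rw [P.right_succ] at h2 h4
  rw [jump, jump, h1, h2, h3, h4, sub_smul]

end Continuous

variable {W C} in
theorem adjointBoundary_iff_of_continuousOn {y : E} {u : ℝ → E}
    (hu : ContinuousOn u (Icc (-P.delay) 0)) :
    AdjointBoundary W C y u ↔
      C.Lτ.adjoint y = Function.rightLim W.ρ (-P.delay) • u (-P.delay) ∧
      ∀ j, (C.Lj j).adjoint y = jump W.ρ (P.node j) • u (P.node j) := by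
  simp only [AdjointBoundary, rightLim_neg_delay_of_continuousOn hu,
    jump_smul_of_continuousOn W hu]

variable {W C} in
theorem smoothElement_mem_adjoint_domain {u : ℝ → E} (hu : ContDiff ℝ ∞ u)
    (h1 : C.Lτ.adjoint (u 0) = Function.rightLim W.ρ (-P.delay) • u (-P.delay))
    (h2 : ∀ j, (C.Lj j).adjoint (u 0) = jump W.ρ (P.node j) • u (P.node j)) :
    smoothElement W hu ∈ (delayOperator W C).adjoint.domain := by
  rw [mem_adjoint_domain_iff]
  exact ⟨u, _, isPiecewiseSobolev_of_isPrimitive (isPrimitive_smoothImage W C hu)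
    (mkElement_snd W _ _),
    (adjointBoundary_iff_of_continuousOn hu.continuous.continuousOn).2 ⟨h1, h2⟩⟩

/-- For smooth u the adjoint conditions involve only u(0), u(-τ) and the node values. Test elements
satisfy them trivially; for given u(0) = x the remaining values are obtained by division, possible
as no jump vanishes, and realized by interpolation. -/
theorem dense_domain_inf_adjoint_domain (hj : ∀ j, jump W.ρ (P.node j) ≠ 0) :
    Dense (((delayOperator W C).domain ⊓ (delayOperator W C).adjoint.domain :
      Submodule ℝ (DelaySpace E W)) : Set (DelaySpace E W)) := by
  refine dense_of_smoothElement_mem _ (fun j η hη hs e => ⟨smoothElement_mem_domain W C _,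
    smoothElement_mem_adjoint_domain _ ?_ fun i => ?_⟩) fun x => ?_
  · simp [testFunction_zero hs, testFunction_neg_delay hs]
  · simp [testFunction_zero hs, testFunction_node hs]
  · obtain ⟨u, hu, h0, hτ, hn⟩ := exists_contDiff_eq P x
      ((Function.rightLim W.ρ (-P.delay))⁻¹ • C.Lτ.adjoint x)
      fun j => (jump W.ρ (P.node j))⁻¹ • (C.Lj j).adjoint x
    refine ⟨u, hu, h0, smoothElement_mem_domain W C _,
      smoothElement_mem_adjoint_domain _ ?_ fun j => ?_⟩
    · rw [h0, hτ, smul_inv_smul₀ W.rightLim_neg_delay_pos.ne']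
    · rw [h0, hn, smul_inv_smul₀ (hj j)]

theorem symmMatrix_inner (x y : E) :
    inner ℝ (symmMatrix W C x) y = inner ℝ x (symmMatrix W C y) := by
  simp only [symmMatrix, add_apply, sum_apply, smul_apply,
    ContinuousLinearMap.comp_apply, ContinuousLinearMap.id_apply, inner_add_left, inner_add_right,
    sum_inner, inner_sum, inner_smul_left, inner_smul_right, ContinuousLinearMap.adjoint_inner_left,
    ContinuousLinearMap.adjoint_inner_right, conj_trivial]
  simp only [← ContinuousLinearMap.adjoint_inner_right, ContinuousLinearMap.adjoint_adjoint]
  simp only [← ContinuousLinearMap.adjoint_inner_left, ContinuousLinearMap.adjoint_adjoint]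
  ring

/-- The function component of the symmetrization. -/
def symmSnd (p : DelaySpace E W) (θ : ℝ) : E :=
  (1 / 2 : ℝ) • (-(deriv W.ρ θ / W.ρ θ) • p.snd θ + (W.ρ θ)⁻¹ • C.kernel p.fst θ)

theorem memLp_symmSnd (p : DelaySpace E W) :
    MemLp (symmSnd W C p) 2 (volume.restrict (Ioo (-P.delay) 0)) := by
  have h := (memLp_logDeriv_smul W (W.memLp_volume p.snd)).neg.add
    (memLp_inv_rho_smul W (C.memLp_kernel p.fst))
  refine (h.const_smul (1 / 2 : ℝ)).ae_eq (Filter.Eventually.of_forall fun θ => ?_)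
  simp [symmSnd]

/-- The value of the symmetrization at `p`. -/
def symmVector (p : DelaySpace E W) : DelaySpace E W :=
  mkElement W ((1 / 2 : ℝ) • (symmMatrix W C p.fst + C.integralPart p.snd)) (memLp_symmSnd W C p)

/-- Multiplication by ρ clears the denominators in `symmSnd` and transposition handles the integral
term, so that the form becomes visibly symmetric in p and s. -/
theorem inner_symmVector (p s : DelaySpace E W) :
    inner ℝ (symmVector W C p) s = 2⁻¹ * (inner ℝ (symmMatrix W C p.fst) s.fst +
      (∫ θ in Ioo (-P.delay) 0, inner ℝ (p.snd θ) (C.kernel s.fst θ)) +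
      (∫ θ in Ioo (-P.delay) 0, inner ℝ (s.snd θ) (C.kernel p.fst θ)) -
      ∫ θ in Ioo (-P.delay) 0, inner ℝ (p.snd θ) (deriv W.ρ θ • s.snd θ)) := by
  have hp := W.memLp_volume p.snd
  have hs := W.memLp_volume s.snd
  have hd : MemLp (fun θ => deriv W.ρ θ • s.snd θ) 2 (volume.restrict (Ioo (-P.delay) 0)) :=
    memLp_smul_of_bound W.aemeasurable_deriv W.exists_bound_deriv hs
  have e : ∫ θ in Ioo (-P.delay) 0, W.ρ θ * inner ℝ (symmSnd W C p θ) (s.snd θ) =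
      2⁻¹ * ((∫ θ in Ioo (-P.delay) 0, inner ℝ (s.snd θ) (C.kernel p.fst θ)) -
        ∫ θ in Ioo (-P.delay) 0, inner ℝ (p.snd θ) (deriv W.ρ θ • s.snd θ)) := by
    rw [← integral_sub (integrable_inner_of_memLp hs (C.memLp_kernel _))
      (integrable_inner_of_memLp hp hd), ← integral_const_mul]
    refine setIntegral_congr_fun measurableSet_Ioo fun θ hθ => ?_
    have hρ : W.ρ θ ≠ 0 := (W.pos_of_mem (Ioo_subset_Icc_self hθ)).ne'
    simp only [symmSnd, inner_smul_left, inner_add_left, inner_smul_right, conj_trivial]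
    rw [real_inner_comm (s.snd θ) (C.kernel p.fst θ)]
    field_simp
    ring
  rw [symmVector, inner_eq_of_ae W _ s (mkElement_snd W _ _) (ae_eq_refl _), e, mkElement_fst,
    inner_smul_left, inner_add_left, C.inner_integralPart hp]
  simp only [conj_trivial]
  ring

theorem symmVector_symmetric (p s : DelaySpace E W) :
    inner ℝ (symmVector W C p) s = inner ℝ p (symmVector W C s) := by
  rw [← real_inner_comm p, inner_symmVector, inner_symmVector, symmMatrix_inner,
    real_inner_comm p.fst]
  have : ∫ θ in Ioo (-P.delay) 0, inner ℝ (p.snd θ) (deriv W.ρ θ • s.snd θ) =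
      ∫ θ in Ioo (-P.delay) 0, inner ℝ (s.snd θ) (deriv W.ρ θ • p.snd θ) := by
    refine integral_congr_ae (Filter.Eventually.of_forall fun θ => ?_)
    simp only [inner_smul_right]
    rw [real_inner_comm]
  rw [this]
  ring

/-- The bounded self-adjoint operator which symmetrizes the delay operator. -/
def symmOperator : DelaySpace E W →L[ℝ] DelaySpace E W :=
  -- An everywhere defined symmetric map is automatically linear, since inner products determine
  -- vectors, and then bounded by the Hellinger–Toeplitz theorem.
  let T : DelaySpace E W →ₗ[ℝ] DelaySpace E W :=
    { toFun := symmVector W C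
      map_add' := fun p q => ext_inner_right ℝ fun s => by
        simp only [inner_add_left, symmVector_symmetric]
      map_smul' := fun c p => ext_inner_right ℝ fun s => by
        simp only [inner_smul_left, symmVector_symmetric, RingHom.id_apply] }
  ⟨T, LinearMap.IsSymmetric.continuous (T := T) fun p s => symmVector_symmetric W C p s⟩

theorem symmOperator_apply (p : DelaySpace E W) : symmOperator W C p = symmVector W C p := rfl

theorem isSelfAdjoint_symmOperator : IsSelfAdjoint (symmOperator W C) :=
  LinearMap.IsSymmetric.isSelfAdjoint fun p s => symmVector_symmetric W C p s

/-- The deviation of `u` from the adjoint boundary conditions. -/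
def boundaryDefect (x : E) (u : ℝ → E) : E :=
  C.Lτ (u (-P.delay) - (Function.rightLim W.ρ (-P.delay))⁻¹ • C.Lτ.adjoint x) +
    ∑ j, C.Lj j (u (P.node j) - (jump W.ρ (P.node j))⁻¹ • (C.Lj j).adjoint x)

/-- Stated on all of D(L), where the adjoint vector is only a formal expression. The derivatives φ'
and -φ' cancel; replacing the point values in the functional by those which the adjoint conditions
would force leaves exactly the boundary defect. -/
theorem half_add_adjointVector {p q : DelaySpace E W} {u : ℝ → E}
    (hu : IsPrimitive (-P.delay) 0 u q.snd)
    (hpu : p.snd =ᵐ[volume.restrict (Ioo (-P.delay) 0)] u) (h0 : u 0 = p.fst)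
    (hq : q.fst = C.functional u) :
    (1 / 2 : ℝ) • (q + adjointVector W C p u (W.memLp_volume q.snd)) = symmVector W C p +
      WithLp.toLp 2 ((1 / 2 : ℝ) • boundaryDefect W C p.fst u, 0) := by
  refine delaySpace_ext ?_ ?_
  · change (1 / 2 : ℝ) • (q.fst + (C.L₀.adjoint p.fst +
      Function.leftLim W.ρ 0 • Function.leftLim u 0)) = (1 / 2 : ℝ) • _ + (1 / 2 : ℝ) • _
    rw [← smul_add, hq, leftLim_zero_of_continuousOn hu.continuousOn, h0,
      C.integralPart_congr hpu]
    congr 1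
    simp only [symmMatrix, boundaryDefect, DelayCoeffs.functional, add_apply, sum_apply, smul_apply,
      ContinuousLinearMap.comp_apply, ContinuousLinearMap.id_apply, map_sub, map_smul,
      Finset.sum_sub_distrib, h0]
    abel
  · have e1 := W.ae_eq_volume (Lp.coeFn_smul (1 / 2 : ℝ)
      (q + adjointVector W C p u (W.memLp_volume q.snd)).snd)
    have e2 := W.ae_eq_volume (Lp.coeFn_add q.snd
      (adjointVector W C p u (W.memLp_volume q.snd)).snd)
    have e3 := mkElement_snd W (C.L₀.adjoint p.fst + Function.leftLim W.ρ 0 • Function.leftLim u 0)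
      (memLp_adjointSnd W C p.fst (W.memLp_volume p.snd) (W.memLp_volume q.snd))
    have e4 := mkElement_snd W ((1 / 2 : ℝ) • (symmMatrix W C p.fst + C.integralPart p.snd))
      (memLp_symmSnd W C p)
    change _ =ᵐ[_] ((symmVector W C p).snd + 0 : Lp E 2 W.measure)
    rw [add_zero]
    refine e1.trans ?_
    filter_upwards [e2, e3, e4] with θ h2 h3 h4
    rw [Pi.smul_apply]
    refine Eq.trans ?_ h4.symm
    refine (congrArg _ (h2.trans (congrArg₂ (· + ·) rfl h3))).trans ?_
    simp only [adjointSnd, symmSnd]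
    congr 1
    rw [neg_smul]
    abel

theorem half_add_adjoint_eq (hj : ∀ j, jump W.ρ (P.node j) ≠ 0)
    {p : DelaySpace E W} (h1 : p ∈ (delayOperator W C).domain)
    (h2 : p ∈ (delayOperator W C).adjoint.domain) :
    (1 / 2 : ℝ) • (delayOperator W C ⟨p, h1⟩ + (delayOperator W C).adjoint ⟨p, h2⟩) =
      symmOperator W C p := by
  obtain ⟨u, hu, hpu, h0, hq⟩ := (delayRel_apply W C ⟨p, h1⟩).exists_isPrimitive
  have hs := isPiecewiseSobolev_of_isPrimitive hu hpu
  obtain ⟨hb, hadj⟩ := (isAdjointPair_adjoint W C ⟨p, h2⟩).eq_adjointVector hs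
  rw [adjointBoundary_iff_of_continuousOn hu.continuousOn] at hb
  have hdef : boundaryDefect W C p.fst u = 0 := by
    rw [boundaryDefect, hb.1, inv_smul_smul₀ W.rightLim_neg_delay_pos.ne']
    simp only [hb.2, inv_smul_smul₀ (hj _), sub_self, map_zero, Finset.sum_const_zero, add_zero]
  rw [hadj, half_add_adjointVector W C hu hpu h0 hq, symmOperator_apply, hdef, smul_zero]
  exact add_zero _

theorem isAdditiveSymmetrization_iff (hj : ∀ j, jump W.ρ (P.node j) ≠ 0)
    (S : DelaySpace E W →ₗ.[ℝ] DelaySpace E W) :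
    IsAdditiveSymmetrization (delayOperator W C) S ↔
      S = (symmOperator W C : DelaySpace E W →ₗ[ℝ] DelaySpace E W).toPMap ⊤ := by
  have hD := dense_domain_inf_adjoint_domain W C hj
  constructor
  · rintro ⟨-, hS, hle⟩
    refine eq_toPMap_top_of_eqOn_dense (isSelfAdjoint_symmOperator W C) hS hD hle.1 fun x hx => ?_
    rw [← half_add_adjoint_eq W C hj hx.1 hx.2]
    exact (hle.2 (x := ⟨x, hx⟩) rfl).symm
  · rintro rfl
    refine ⟨hD, isSelfAdjoint_toPMap_top (isSelfAdjoint_symmOperator W C), le_top, ?_⟩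
    rintro ⟨x, hx⟩ ⟨y, hy⟩ (rfl : x = y)
    exact half_add_adjoint_eq W C hj hx.1 hx.2

end Symmetrization

/-! ### Trace numbers of operators dominated by a bounded operator -/

section Trace

variable {H : Type*} [NormedAddCommGroup H] [InnerProductSpace ℝ H]

theorem compressionTrace_eq_sum (A : H →ₗ.[ℝ] H) (V : Submodule ℝ H) [FiniteDimensional ℝ V]
    (hV : V ≤ A.domain) {ι : Type*} [Fintype ι] (b : OrthonormalBasis ι ℝ V) :
    compressionTrace A V hV = ∑ i, inner ℝ (b i : H) (A ⟨b i, hV (b i).2⟩) := by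
  rw [compressionTrace, LinearMap.trace_eq_sum_inner _ b]
  refine Finset.sum_congr rfl fun i _ => ?_
  exact Submodule.inner_orthogonalProjectionOnto_eq_of_mem_left (b i) _

/-- The orthonormal basis of its span given by an orthonormal family. -/
def orthonormalBasisSpan {ι : Type*} [Fintype ι] {e : ι → H} (he : Orthonormal ℝ e) :
    OrthonormalBasis ι ℝ (Submodule.span ℝ (range e)) :=
  (Module.Basis.span he.linearIndependent).toOrthonormalBasis (by
    rw [← Submodule.subtypeₗᵢ _ |>.orthonormal_comp_iff]
    convert he using 1
    funext i
    simp [Module.Basis.span_apply])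

theorem coe_orthonormalBasisSpan {ι : Type*} [Fintype ι] {e : ι → H} (he : Orthonormal ℝ e)
    (i : ι) :
    (orthonormalBasisSpan he i : H) = e i := by
  simp [orthonormalBasisSpan, Module.Basis.span_apply]

/-- Induction along the recursion: each projection divides by the squared norm of an earlier vector,
which is nonzero at a linearly independent family. -/
theorem continuousAt_gramSchmidt {k : ℕ} {e : Fin k → H} (he : LinearIndependent ℝ e) (n : Fin k) :
    ContinuousAt (fun f : Fin k → H => InnerProductSpace.gramSchmidt ℝ f n) e := by
  induction n using WellFoundedLT.induction with
  | _ n ih =>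
    have hdef : (fun f : Fin k → H => InnerProductSpace.gramSchmidt ℝ f n) = fun f => f n -
        ∑ i ∈ Finset.Iio n, (inner ℝ (InnerProductSpace.gramSchmidt ℝ f i) (f n) /
          ‖InnerProductSpace.gramSchmidt ℝ f i‖ ^ 2) • InnerProductSpace.gramSchmidt ℝ f i := by
      funext f
      rw [InnerProductSpace.gramSchmidt_def]
      simp only [Submodule.starProjection_singleton]
      rfl
    rw [hdef]
    refine (continuous_apply n).continuousAt.sub (tendsto_finsetSum _ fun i hi => ?_)
    have hc := ih i (Finset.mem_Iio.1 hi)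
    have hne : ‖InnerProductSpace.gramSchmidt ℝ e i‖ ^ 2 ≠ 0 :=
      pow_ne_zero 2 (norm_ne_zero_iff.2 (InnerProductSpace.gramSchmidt_ne_zero i he))
    exact ((hc.inner (continuous_apply n).continuousAt).div (hc.norm.pow 2) hne).smul hc

theorem continuousAt_gramSchmidtNormed {k : ℕ} {e : Fin k → H} (he : LinearIndependent ℝ e)
    (n : Fin k) :
    ContinuousAt (fun f : Fin k → H => InnerProductSpace.gramSchmidtNormed ℝ f n) e := by
  have hc := continuousAt_gramSchmidt he n
  exact (hc.norm.inv₀ (norm_ne_zero_iff.2 (InnerProductSpace.gramSchmidt_ne_zero n he))).smul hc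

theorem gramSchmidtNormed_of_orthonormal {k : ℕ} {e : Fin k → H} (he : Orthonormal ℝ e) :
    InnerProductSpace.gramSchmidtNormed ℝ e = e := by
  funext n
  rw [InnerProductSpace.gramSchmidtNormed,
    InnerProductSpace.gramSchmidt_of_orthogonal ℝ fun i j hij => he.2 hij, he.1 n]
  simp

theorem compressionTrace_le_traceSupOn (A : H →ₗ.[ℝ] H) {D V : Submodule ℝ H} {k : ℕ}
    (hV : V ≤ A.domain ⊓ D) [hf : FiniteDimensional ℝ V] (hk : Module.finrank ℝ V = k) :
    ((compressionTrace A V (hV.trans inf_le_left) : ℝ) : EReal) ≤ traceSupOn A D k :=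
  le_iSup_of_le V (le_iSup_of_le hV (le_iSup_of_le hf (le_iSup_of_le hk le_rfl)))

theorem traceSupOn_le {A : H →ₗ.[ℝ] H} {D : Submodule ℝ H} {k : ℕ} {M : EReal}
    (h : ∀ (V : Submodule ℝ H) (hV : V ≤ A.domain ⊓ D) [FiniteDimensional ℝ V],
      Module.finrank ℝ V = k →
        ((compressionTrace A V (hV.trans inf_le_left) : ℝ) : EReal) ≤ M) :
    traceSupOn A D k ≤ M :=
  iSup_le fun V => iSup_le fun hV => iSup_le fun _ => iSup_le fun hk => h V hV hk

theorem traceSupOn_le_traceSup (A : H →ₗ.[ℝ] H) (D : Submodule ℝ H) (k : ℕ) :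
    traceSupOn A D k ≤ traceSup A k :=
  traceSupOn_le fun _ hV _ hk =>
    compressionTrace_le_traceSupOn A (le_inf (hV.trans inf_le_left) (hV.trans inf_le_left)) hk

theorem traceSup_zero (A : H →ₗ.[ℝ] H) : traceSup A 0 = 0 := by
  have key : ∀ (V : Submodule ℝ H) (hV : V ≤ A.domain) [FiniteDimensional ℝ V],
      Module.finrank ℝ V = 0 → compressionTrace A V hV = 0 := fun V hV _ hk => by
    rw [compressionTrace_eq_sum A V hV ((stdOrthonormalBasis ℝ V).reindex (finCongr hk))]
    simp
  refine le_antisymm (traceSupOn_le fun V hV _ hk => ?_) ?_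
  · rw [key V _ hk, EReal.coe_zero]
  · have h := compressionTrace_le_traceSupOn A (D := A.domain) (V := ⊥) (k := 0) bot_le (by simp)
    rwa [key _ _ (by simp), EReal.coe_zero] at h

variable {A : H →ₗ.[ℝ] H} {B : H →L[ℝ] H}

theorem traceSup_le_traceSup_toPMap
    (hle : ∀ x : A.domain, inner ℝ (x : H) (A x) ≤ inner ℝ (x : H) (B x)) (k : ℕ) :
    traceSup A k ≤ traceSup ((B : H →ₗ[ℝ] H).toPMap ⊤) k := by
  refine traceSupOn_le fun V hV _ hk => le_trans ?_
    (compressionTrace_le_traceSupOn _ (V := V) (le_inf le_top le_top) hk)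
  rw [EReal.coe_le_coe_iff, compressionTrace_eq_sum A V _ (stdOrthonormalBasis ℝ V),
    compressionTrace_eq_sum _ V _ (stdOrthonormalBasis ℝ V)]
  exact Finset.sum_le_sum fun i _ => hle ⟨_, (hV.trans inf_le_left) (stdOrthonormalBasis ℝ V i).2⟩

/-- Perturbs an orthonormal basis of V into the dense subspace and orthonormalizes again. The span
stays in the subspace, where the quadratic forms of A and B agree, and the trace moves little
because B is bounded. -/
theorem traceSup_toPMap_le_traceSupOn {D : Submodule ℝ H}
    (hD : Dense ((A.domain ⊓ D : Submodule ℝ H) : Set H))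
    (heq : ∀ (x : H) (hx : x ∈ A.domain ⊓ D), inner ℝ x (A ⟨x, hx.1⟩) = inner ℝ x (B x)) (k : ℕ) :
    traceSup ((B : H →ₗ[ℝ] H).toPMap ⊤) k ≤ traceSupOn A D k := by
  refine traceSupOn_le fun V hV _ hk => ?_
  set b := (stdOrthonormalBasis ℝ V).reindex (finCongr hk)
  let e : Fin k → H := fun i => b i
  have he : Orthonormal ℝ e := (V.subtypeₗᵢ.orthonormal_comp_iff).2 b.orthonormal
  -- For independent f this is the trace of B compressed to the span of f, written as a function of
  -- the tuple so that its continuity at e can be used.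
  let Φ : (Fin k → H) → ℝ := fun f => ∑ i, inner ℝ (InnerProductSpace.gramSchmidtNormed ℝ f i)
    (B (InnerProductSpace.gramSchmidtNormed ℝ f i))
  have hΦe : compressionTrace ((B : H →ₗ[ℝ] H).toPMap ⊤) V (hV.trans inf_le_left) = Φ e := by
    rw [compressionTrace_eq_sum _ V _ b]
    simp only [Φ, gramSchmidtNormed_of_orthonormal he]
    rfl
  have hΦc : ContinuousAt Φ e := by
    refine tendsto_finsetSum _ fun i _ => ?_
    have hc := continuousAt_gramSchmidtNormed he.linearIndependent i
    exact hc.inner (B.continuous.continuousAt.comp hc)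
  rw [hΦe]
  refine le_of_forall_lt_imp_le_of_dense fun c hc => ?_
  have h1 : ∀ᶠ f in nhds e, c < (Φ f : EReal) :=
    (continuous_coe_real_ereal.continuousAt.comp hΦc).eventually_const_lt hc
  have h2 : ∀ᶠ f in nhds e, LinearIndependent ℝ f :=
    -- Independence is an open condition, so a nearby tuple from the dense subspace still spans a
    -- k-dimensional space.
    isOpen_setOfPred_linearIndependent.mem_nhds he.linearIndependent
  have hdense : Dense ((univ : Set (Fin k)).pi
      fun _ => ((A.domain ⊓ D : Submodule ℝ H) : Set H)) := dense_pi _ fun _ _ => hD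
  obtain ⟨f, hfD, hcf, hfi⟩ := hdense.inter_nhds_nonempty (h1.and h2)
  have hon := InnerProductSpace.gramSchmidtNormed_orthonormal hfi
  have hspan : Submodule.span ℝ (range (InnerProductSpace.gramSchmidtNormed ℝ f)) ≤
      A.domain ⊓ D := by
    rw [InnerProductSpace.span_gramSchmidtNormed_range, InnerProductSpace.span_gramSchmidt,
      Submodule.span_le]
    rintro _ ⟨i, rfl⟩
    exact hfD i (mem_univ i)
  have hfin : Module.finrank ℝ
      (Submodule.span ℝ (range (InnerProductSpace.gramSchmidtNormed ℝ f))) = k := by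
    rw [finrank_span_eq_card hon.linearIndependent, Fintype.card_fin]
  have := FiniteDimensional.span_of_finite ℝ
    (finite_range (InnerProductSpace.gramSchmidtNormed ℝ f))
  refine hcf.le.trans (le_trans (le_of_eq ?_) (compressionTrace_le_traceSupOn A hspan hfin))
  rw [compressionTrace_eq_sum A _ _ (orthonormalBasisSpan hon)]
  congr 1
  refine Finset.sum_congr rfl fun i _ => ?_
  rw [heq _ (hspan (orthonormalBasisSpan hon i).2), coe_orthonormalBasisSpan]

/-- The bound k‖B‖ excludes +∞, and a k-dimensional subspace excludes -∞, the supremum of the empty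
family. -/
theorem traceSup_toPMap_eq_coe (B : H →L[ℝ] H) {k : ℕ}
    (hk : ∃ v : Fin k → H, LinearIndependent ℝ v) :
    ∃ t : ℝ, traceSup ((B : H →ₗ[ℝ] H).toPMap ⊤) k = t := by
  have htop : traceSup ((B : H →ₗ[ℝ] H).toPMap ⊤) k ≤ ((k * ‖B‖ : ℝ) : EReal) := by
    refine traceSupOn_le fun V hV _ hV' => ?_
    rw [EReal.coe_le_coe_iff,
      compressionTrace_eq_sum _ V _ ((stdOrthonormalBasis ℝ V).reindex (finCongr hV'))]
    set b := (stdOrthonormalBasis ℝ V).reindex (finCongr hV')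
    have : ∀ i, inner ℝ (b i : H) (B (b i)) ≤ ‖B‖ := fun i => by
      have hb : ‖(b i : H)‖ = 1 := b.orthonormal.1 i
      calc inner ℝ (b i : H) (B (b i)) ≤ ‖(b i : H)‖ * ‖B (b i)‖ := real_inner_le_norm _ _
        _ ≤ 1 * (‖B‖ * 1) := by
          rw [hb]
          gcongr
          simpa [hb] using B.le_opNorm (b i : H)
        _ = ‖B‖ := by ring
    refine (Finset.sum_le_sum fun i _ => this i).trans ?_
    simp
  obtain ⟨v, hv⟩ := hk
  have := FiniteDimensional.span_of_finite ℝ (finite_range v)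
  have hbot := compressionTrace_le_traceSupOn ((B : H →ₗ[ℝ] H).toPMap ⊤) (D := ⊤) (k := k)
    (V := Submodule.span ℝ (range v)) (le_inf le_top le_top)
    (by rw [finrank_span_eq_card hv, Fintype.card_fin])
  refine ⟨_, (EReal.coe_toReal (ne_top_of_le_ne_top (EReal.coe_ne_top _) htop)
    (ne_bot_of_le_ne_bot (EReal.coe_ne_bot _) hbot)).symm⟩

theorem traceNumber_eq_coe {t : ℕ → ℝ} (ht : ∀ k, traceSup A k = t k) (k : ℕ) :
    traceNumber A k = ((t k - t (k - 1) : ℝ) : EReal) := by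
  rw [traceNumber, if_neg (by rw [ht]; exact EReal.coe_ne_top _), ht, ht, EReal.coe_sub]

/-- The sum telescopes. Finiteness of all partial suprema is essential, since subtraction in `EReal`
does not cancel at infinite values; `traceSup_zero` starts the induction. -/
theorem sum_traceNumber {t : ℕ → ℝ} (ht : ∀ k, traceSup A k = t k) (k : ℕ) :
    ∑ j ∈ Finset.Icc 1 k, traceNumber A j = traceSup A k := by
  induction k with
  | zero => simp [traceSup_zero]
  | succ k ih =>
    rw [Finset.sum_Icc_succ_top (by omega), ih, traceNumber_eq_coe ht, ht, ht, ← EReal.coe_add]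
    simp

end Trace

/-! ### Trace numbers of the delay operator -/

section DelayTrace

variable {E : Type*} [NormedAddCommGroup E] [InnerProductSpace ℝ E] {J I : ℕ}
  {P : DelayPartition J} (W : Weight P) (C : DelayCoeffs E P I)

theorem memLp_polynomial (P : DelayPartition J) (e : E) (p : Polynomial ℝ) :
    MemLp (fun θ => p.eval θ • e) 2 (volume.restrict (Ioo (-P.delay) 0)) :=
  memLp_of_continuousOn (by fun_prop)

/-- Polynomials as elements of the delay space. -/
def polynomialElement (e : E) : Polynomial ℝ →ₗ[ℝ] DelaySpace E W where
  toFun p := mkElement W 0 (memLp_polynomial P e p)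
  map_add' p q := by
    refine delaySpace_ext (add_zero (0 : E)).symm ?_
    have h := W.ae_eq_volume (Lp.coeFn_add (mkElement W 0 (memLp_polynomial P e p)).snd
      (mkElement W 0 (memLp_polynomial P e q)).snd)
    refine (mkElement_snd W _ _).trans (Filter.EventuallyEq.trans ?_ h.symm)
    filter_upwards [mkElement_snd W 0 (memLp_polynomial P e p),
      mkElement_snd W 0 (memLp_polynomial P e q)] with θ h1 h2
    rw [Pi.add_apply, h1, h2, Polynomial.eval_add, add_smul]
  map_smul' c p := by
    refine delaySpace_ext (smul_zero c).symm ?_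
    have h := W.ae_eq_volume (Lp.coeFn_smul c (mkElement W 0 (memLp_polynomial P e p)).snd)
    refine (mkElement_snd W _ _).trans (Filter.EventuallyEq.trans ?_ h.symm)
    filter_upwards [mkElement_snd W 0 (memLp_polynomial P e p)] with θ h1
    rw [Pi.smul_apply, h1, Polynomial.eval_smul, smul_eq_mul, mul_smul]

theorem polynomialElement_injective {e : E} (he : e ≠ 0) :
    Function.Injective (polynomialElement W e) := by
  rw [injective_iff_map_eq_zero]
  intro p hp
  have h1 : (fun θ => p.eval θ • e) =ᵐ[volume.restrict (Ioo (-P.delay) 0)] (0 : ℝ → E) := by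
    refine (mkElement_snd W 0 (memLp_polynomial P e p)).symm.trans ?_
    have h2 : (mkElement W 0 (memLp_polynomial P e p)).snd = 0 :=
      congrArg (fun s : DelaySpace E W => s.snd) hp
    rw [h2]
    exact W.ae_eq_volume (Lp.coeFn_zero E 2 W.measure)
  have h3 : EqOn (fun θ => p.eval θ • e) (0 : ℝ → E) (Icc (-P.delay) 0) := by
    refine Measure.eqOn_Icc_of_ae_eq volume P.neg_delay_lt_zero.ne ?_ (by fun_prop)
      continuousOn_const
    rwa [← restrict_Ioo_eq_restrict_Icc]
  refine Polynomial.eq_zero_of_infinite_isRoot p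
    ((Icc_infinite P.neg_delay_lt_zero).mono fun θ hθ => ?_)
  exact (smul_eq_zero.1 (h3 hθ)).resolve_right he

/-- Monomials times a fixed nonzero vector are independent in the function component, so subspaces
of every finite dimension exist. -/
theorem exists_linearIndependent [Nontrivial E] (k : ℕ) :
    ∃ v : Fin k → DelaySpace E W, LinearIndependent ℝ v := by
  obtain ⟨e, he⟩ := exists_ne (0 : E)
  have h := (Polynomial.basisMonomials ℝ).linearIndependent.map' (polynomialElement W e)
    (LinearMap.ker_eq_bot.2 (polynomialElement_injective W he))
  exact ⟨_, h.comp (fun i : Fin k => (i : ℕ)) Fin.val_injective⟩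

/-- To be used with c = ρ(-τ) or c = Δ_j(ρ), α the adjoint coefficient applied to x, and u the point
value of φ. The first term comes from the boundary defect, the second from Green's formula. -/
theorem inner_completeSquare {c : ℝ} (hc : 0 < c) (u α : E) :
    inner ℝ (u - c⁻¹ • α) α + inner ℝ u (α - c • u) ≤ 0 := by
  have h : inner ℝ (u - c⁻¹ • α) α + inner ℝ u (α - c • u) =
      -(c * inner ℝ (u - c⁻¹ • α) (u - c⁻¹ • α)) := by
    simp only [inner_sub_left, inner_sub_right, inner_smul_left, inner_smul_right, conj_trivial,
      real_inner_comm u α]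
    field_simp
    ring
  rw [h, neg_nonpos]
  exact mul_nonneg hc.le real_inner_self_nonneg

variable [CompleteSpace E]

/-- Green's formula with s = p compares ⟨Lp, p⟩ with the formal adjoint term, and
`half_add_adjointVector` compares their mean with ⟨S_L p, p⟩. The discrepancy is half the sum of the
completed squares, all nonpositive because the weights are positive. -/
theorem inner_delayOperator_le (hj : ∀ j, 0 < jump W.ρ (P.node j))
    (p : (delayOperator W C).domain) :
    inner ℝ (p : DelaySpace E W) (delayOperator W C p) ≤
      inner ℝ (p : DelaySpace E W) (symmOperator W C p) := by
  obtain ⟨u, hu, hpu, h0, hq⟩ := (delayRel_apply W C p).exists_isPrimitive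
  have hs := isPiecewiseSobolev_of_isPrimitive hu hpu
  have green := inner_green W C hu hpu h0 hq hs
  have half := congrArg (fun z => inner ℝ z (p : DelaySpace E W))
    (half_add_adjointVector W C hu hpu h0 hq)
  simp only [rightLim_neg_delay_of_continuousOn hu.continuousOn,
    jump_smul_of_continuousOn W hu.continuousOn] at green
  set x := (p : DelaySpace E W).fst
  have e1 : inner ℝ (WithLp.toLp 2 ((1 / 2 : ℝ) • boundaryDefect W C x u, 0) : DelaySpace E W)
      (p : DelaySpace E W) = 2⁻¹ * inner ℝ (boundaryDefect W C x u) x := by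
    rw [WithLp.prod_inner_apply]
    change inner ℝ ((1 / 2 : ℝ) • boundaryDefect W C x u) x +
      inner ℝ (0 : Lp E 2 W.measure) (p : DelaySpace E W).snd = _
    rw [inner_zero_left, add_zero, inner_smul_left]
    simp
  have e2 : inner ℝ (boundaryDefect W C x u) x =
      inner ℝ (u (-P.delay) - (Function.rightLim W.ρ (-P.delay))⁻¹ • C.Lτ.adjoint x)
        (C.Lτ.adjoint x) + ∑ j, inner ℝ (u (P.node j) - (jump W.ρ (P.node j))⁻¹ •
          (C.Lj j).adjoint x) ((C.Lj j).adjoint x) := by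
    simp only [boundaryDefect, inner_add_left, sum_inner, ContinuousLinearMap.adjoint_inner_right]
  rw [inner_smul_left, inner_add_left, inner_add_left, e1, e2] at half
  have hτ := inner_completeSquare W.rightLim_neg_delay_pos (u (-P.delay)) (C.Lτ.adjoint x)
  have hn : ∑ j, (inner ℝ (u (P.node j) - (jump W.ρ (P.node j))⁻¹ • (C.Lj j).adjoint x)
      ((C.Lj j).adjoint x) + inner ℝ (u (P.node j)) ((C.Lj j).adjoint x -
        jump W.ρ (P.node j) • u (P.node j))) ≤ 0 :=
    Finset.sum_nonpos fun j _ => inner_completeSquare (hj j) _ _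
  rw [Finset.sum_add_distrib] at hn
  rw [real_inner_comm, real_inner_comm (symmOperator W C p), symmOperator_apply]
  have hcomm := real_inner_comm (p : DelaySpace E W) (adjointVector W C p u hs.memLp)
  have hstar : (starRingEnd ℝ) (1 / 2 : ℝ) = 1 / 2 := conj_trivial _
  rw [hstar] at half
  linarith

/-- On the common domain ⟨Lp, p⟩ = ⟨p, L*p⟩, so either one equals the quadratic form of the mean. -/
theorem inner_delayOperator_eq (hj : ∀ j, jump W.ρ (P.node j) ≠ 0) (p : DelaySpace E W)
    (hp : p ∈ (delayOperator W C).domain ⊓ (delayOperator W C).adjoint.domain) :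
    inner ℝ p (delayOperator W C ⟨p, hp.1⟩) = inner ℝ p (symmOperator W C p) := by
  have h := isAdjointPair_adjoint W C ⟨p, hp.2⟩ p _ (delayRel_apply W C ⟨p, hp.1⟩)
  rw [← half_add_adjoint_eq W C hj hp.1 hp.2, inner_smul_right, inner_add_right, ← h,
    real_inner_comm p]
  ring

/-- The three suprema form a cycle of inequalities: L is dominated by S_L, S_L by L restricted to
the common domain, and the restriction by L. -/
theorem traceSup_delayOperator (hj : ∀ j, 0 < jump W.ρ (P.node j)) (k : ℕ) :
    traceSup (delayOperator W C) k = traceSup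
      ((symmOperator W C : DelaySpace E W →ₗ[ℝ] DelaySpace E W).toPMap ⊤) k ∧
    traceSup (delayOperator W C) k =
      traceSupOn (delayOperator W C) (delayOperator W C).adjoint.domain k := by
  have hj' : ∀ j, jump W.ρ (P.node j) ≠ 0 := fun j => (hj j).ne'
  have h1 := traceSup_le_traceSup_toPMap (inner_delayOperator_le W C hj) k
  have h2 := traceSup_toPMap_le_traceSupOn (B := symmOperator W C)
    (dense_domain_inf_adjoint_domain W C hj') (inner_delayOperator_eq W C hj') k
  have h3 := traceSupOn_le_traceSup (delayOperator W C) (delayOperator W C).adjoint.domain k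
  exact ⟨le_antisymm h1 (h2.trans h3), le_antisymm (h1.trans h2) h3⟩

end DelayTrace

end DelaySymm

end

/-! ### Assembly of the three statements -/

theorem mainTheorem8 {E : Type*} [NormedAddCommGroup E] [InnerProductSpace ℝ E]
    [FiniteDimensional ℝ E] [CompleteSpace E] [Nontrivial E] {J I : ℕ}
    (P : DelayPartition J) (W : Weight P) (C : DelayCoeffs E P I) :
    -- the adjoint of `L` : its domain and its action
    (Dense ((delayOperator W C).domain : Set (DelaySpace E W)) ∧
      (∀ p : DelaySpace E W, p ∈ (delayOperator W C).adjoint.domain ↔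
        ∃ v g : ℝ → E, IsPiecewiseSobolev P p.snd v g ∧
          AdjointBoundary W C p.fst v) ∧
      ∀ (p : (delayOperator W C).adjoint.domain) (v g : ℝ → E),
        IsPiecewiseSobolev P (p : DelaySpace E W).snd v g →
        ((delayOperator W C).adjoint p).fst =
          C.L₀.adjoint (p : DelaySpace E W).fst +
            Function.leftLim W.ρ 0 • Function.leftLim v 0 ∧
        ∀ᵐ θ ∂(MeasureTheory.volume.restrict (Set.Ioo (-P.delay) 0)),
          ((delayOperator W C).adjoint p).snd θ =
            -g θ - (deriv W.ρ θ / W.ρ θ) • (p : DelaySpace E W).snd θ +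
              (W.ρ θ)⁻¹ • ∑ i, (C.M i θ).adjoint (p : DelaySpace E W).fst) ∧
    -- the unique additive symmetrization of `L`
    ((∀ j, jump W.ρ (P.node j) ≠ 0) →
      (∃! S, IsAdditiveSymmetrization (delayOperator W C) S) ∧
      ∀ S, IsAdditiveSymmetrization (delayOperator W C) S →
        ∃ B : DelaySpace E W →L[ℝ] DelaySpace E W,
          IsSelfAdjoint B ∧ S = (B : _ →ₗ[ℝ] DelaySpace E W).toPMap ⊤ ∧
          ∀ p : DelaySpace E W,
            (B p).fst = (1 / 2 : ℝ) •
              (symmMatrix W C p.fst + C.integralPart p.snd) ∧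
            ∀ᵐ θ ∂(MeasureTheory.volume.restrict (Set.Ioo (-P.delay) 0)),
              (B p).snd θ = (1 / 2 : ℝ) •
                (-(deriv W.ρ θ / W.ρ θ) • p.snd θ +
                  (W.ρ θ)⁻¹ • ∑ i, (C.M i θ).adjoint p.fst)) ∧
    -- exponential weights with positive jumps
    ∀ κ : Fin (J + 1) → ℝ,
      (∀ j, ∀ θ ∈ Set.Ioo (P.left j) (P.right j), W.ρ θ = Real.exp (κ j * θ)) →
      (∀ j, 0 < jump W.ρ (P.node j)) →
      (∀ k : ℕ, 1 ≤ k →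
        (∃ b : ℝ, traceNumber (delayOperator W C) k = b) ∧
        ∑ j ∈ Finset.Icc 1 k, traceNumber (delayOperator W C) j =
          traceSup (delayOperator W C) k ∧
        ∑ j ∈ Finset.Icc 1 k, traceNumber (delayOperator W C) j =
          traceSupOn (delayOperator W C)
            (delayOperator W C).adjoint.domain k) ∧
      ∀ S, IsAdditiveSymmetrization (delayOperator W C) S →
        IsProperAdditiveSymmetrization (delayOperator W C) S := by
  refine ⟨⟨dense_domain W C, mem_adjoint_domain_iff W C, fun p v g hp => ?_⟩, fun hj => ?_,
    fun κ _ hj => ?_⟩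
  · rw [adjoint_apply W C p hp]
    exact ⟨rfl, mkElement_snd W _ _⟩
  · refine ⟨⟨_, (isAdditiveSymmetrization_iff W C hj _).2 rfl,
      fun S hS => (isAdditiveSymmetrization_iff W C hj S).1 hS⟩, fun S hS => ?_⟩
    exact ⟨symmOperator W C, isSelfAdjoint_symmOperator W C,
      (isAdditiveSymmetrization_iff W C hj S).1 hS, fun p =>
      ⟨rfl, mkElement_snd W _ (memLp_symmSnd W C p)⟩⟩
  -- t k is the finite k-th partial sum for S_L, taken for k = 0 as well since β_1 is a difference
  -- with the zeroth one. Equal partial sums for L and S_L give equal trace numbers.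
  · choose t ht using fun k =>
      traceSup_toPMap_eq_coe (symmOperator W C) (exists_linearIndependent W k)
    have htL : ∀ k, traceSup (delayOperator W C) k = t k := fun k =>
      (traceSup_delayOperator W C hj k).1.trans (ht k)
    refine ⟨fun k _ => ⟨⟨_, traceNumber_eq_coe htL k⟩, sum_traceNumber htL k,
      (sum_traceNumber htL k).trans (traceSup_delayOperator W C hj k).2⟩, fun S hS =>
      ⟨hS, fun k _ => ?_⟩⟩
    rw [(isAdditiveSymmetrization_iff W C (fun j => (hj j).ne') S).1 hS,
      traceNumber_eq_coe htL, traceNumber_eq_coe ht]
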